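/- Let ${\rm Vir}=\mathrm{span}_{\mathbb C}\{z,e_j\mid j\in\mathbb Z\}$ be the Virasoro algebra, with $[e_j,e_k]=(k-j)e_{j+k}+\delta_{k,-j}\frac{j^3-j}{12}z$ and $z$ central, and let $\theta:{\rm Vir}\to\mathbb C[t^{\pm1}]$ be the linear map with $\theta(e_j)=t^j$, $\theta(z)=0$. For $\lambda\in\mathbb C^\times$ and $n\ge1$ let ${\rm Vir}^{(t-\lambda)^n}$ be the subalgebra of all $x\in{\rm Vir}$ such that $\theta(x)$ lies in the ideal of $\mathbb C[t^{\pm1}]$ generated by $(t-\lambda)^n$. Write $x_j=\sum_i a_ie_{i+j}$, where $(t-\lambda)^n=\sum_i a_it^i$. For a Lie algebra homomorphism $\mu:{\rm Vir}^{(t-\lambda)^n}\to\mathbb C$ put $V^{(t-\lambda)^n}_\mu=U({\rm Vir})\otimes_{U({\rm Vir}^{(t-\lambda)^n})}\mathbb C_\mu$, where $\mathbb C_\mu$ is the one-dimensional module given by $\mu$. There is a unique polynomial $p$ with $\mu(x_j)=p(j)\lambda^j$ for all $j\in\mathbb Z$; the degree of $\mu$ is the degree of $p$, where the zero polynomial has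 degree $-1$. Let $k\ge1$, let $\lambda_1,\dots,\lambda_k\in\mathbb C^\times$ be distinct, let $n_1,\dots,n_k\ge1$ be integers, and let $\mu_i:{\rm Vir}^{(t-\lambda_i)^{n_i}}\to\mathbb C$ be a homomorphism of degree $r_i$, for $1\le i\le k$. Let $V$ be a ${\rm Vir}$-module that is ${\rm Vir}^+$-locally annihilated: for each $v\in V$ there is an $L\in\mathbb Z_{\ge0}$ with $e_jv=0$ for all $j\ge L$. Then the ${\rm Vir}$-module $$\bigotimes_{i=1}^k V^{(t-\lambda_i)^{n_i}}_{\mu_i}\otimes V$$ is simple if and only if $V$ is simple and, for every $1\le i\le k$, $\mu_i\ne0$ and $r_i\ge n_i-2$. -/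

import Mathlib

open scoped LaurentPolynomial TensorProduct

noncomputable section

/-! ### The Virasoro algebra -/

/-- The Euler derivation `t d/dt` of `ℂ[t, t⁻¹]`, with `t ^ n ↦ n t ^ n`. -/
def eulerD : ℂ[T;T⁻¹] →ₗ[ℂ] ℂ[T;T⁻¹] :=
  Finsupp.lsum ℂ (fun n : ℤ => LinearMap.toSpanSingleton ℂ ℂ[T;T⁻¹] ((n : ℂ) • LaurentPolynomial.T n))
    ∘ₗ (AddMonoidAlgebra.coeffLinearEquiv ℂ).toLinearMap

/-- The coefficient of `t ^ 0`, as a linear form. -/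
def constCoeff : ℂ[T;T⁻¹] →ₗ[ℂ] ℂ :=
  Finsupp.lapply 0 ∘ₗ (AddMonoidAlgebra.coeffLinearEquiv ℂ).toLinearMap

theorem eulerD_C_mul_T (a : ℂ) (n : ℤ) :
    eulerD (LaurentPolynomial.C a * LaurentPolynomial.T n) =
      LaurentPolynomial.C (n * a) * LaurentPolynomial.T n := by
  rw [← LaurentPolynomial.single_eq_C_mul_T, ← LaurentPolynomial.single_eq_C_mul_T]
  change Finsupp.lsum ℂ _ (Finsupp.single n a) = _
  rw [Finsupp.lsum_single, LinearMap.toSpanSingleton_apply, smul_smul, mul_comm a,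
    LaurentPolynomial.smul_eq_C_mul, LaurentPolynomial.single_eq_C_mul_T]

theorem constCoeff_C_mul_T (a : ℂ) (n : ℤ) :
    constCoeff (LaurentPolynomial.C a * LaurentPolynomial.T n) = if n = 0 then a else 0 := by
  rw [← LaurentPolynomial.single_eq_C_mul_T]
  exact Finsupp.single_apply

theorem eulerD_mul (f g : ℂ[T;T⁻¹]) : eulerD (f * g) = eulerD f * g + f * eulerD g := by
  induction f using LaurentPolynomial.induction_on' with
  | add p q hp hq => simp only [add_mul, map_add, hp, hq]; ring
  | C_mul_T n a =>
    induction g using LaurentPolynomial.induction_on' with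
    | add p q hp hq => simp only [mul_add, map_add, hp, hq]; ring
    | C_mul_T m b =>
      rw [show LaurentPolynomial.C a * LaurentPolynomial.T n *
        (LaurentPolynomial.C b * LaurentPolynomial.T m) =
        LaurentPolynomial.C (a * b) * LaurentPolynomial.T (n + m) by
          rw [LaurentPolynomial.T_add, map_mul]; ring]
      rw [eulerD_C_mul_T]
      simp only [eulerD_C_mul_T, LaurentPolynomial.T_add, map_mul, Int.cast_add, map_add]
      ring

/-- The Lie bracket `[f, g] = t (f g' - g f')` on `ℂ[t, t⁻¹]`. -/
def wittBracket : ℂ[T;T⁻¹] →ₗ[ℂ] ℂ[T;T⁻¹] →ₗ[ℂ] ℂ[T;T⁻¹] :=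
  LinearMap.mk₂ ℂ (fun f g => f * eulerD g - g * eulerD f)
    (by intro a b c; simp only [map_add]; ring)
    (by intro c a b; simp only [map_smul, smul_mul_assoc, mul_smul_comm, smul_sub])
    (by intro a b c; simp only [map_add]; ring)
    (by intro c a b; simp only [map_smul, smul_mul_assoc, mul_smul_comm, smul_sub])

/-- The Virasoro cocycle, with `(t ^ j, t ^ k) ↦ δ_{k, -j} (j ^ 3 - j) / 12`. -/
def virCocycle : ℂ[T;T⁻¹] →ₗ[ℂ] ℂ[T;T⁻¹] →ₗ[ℂ] ℂ :=
  LinearMap.mk₂ ℂ (fun f g => constCoeff ((eulerD (eulerD (eulerD f)) - eulerD f) * g) / 12)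
    (by intro a b c; simp only [map_add, add_mul, sub_mul, map_sub]; ring)
    (by intro c a b
        simp only [map_smul, sub_mul, smul_mul_assoc, map_sub, smul_eq_mul]; ring)
    (by intro a b c; simp only [map_add, mul_add]; ring)
    (by intro c a b; simp only [map_smul, mul_smul_comm, smul_eq_mul]; ring)

theorem wittBracket_apply (f g : ℂ[T;T⁻¹]) :
    wittBracket f g = f * eulerD g - g * eulerD f := rfl

theorem wittBracket_C_mul_T (a b : ℂ) (j k : ℤ) :
    wittBracket (LaurentPolynomial.C a * LaurentPolynomial.T j)
      (LaurentPolynomial.C b * LaurentPolynomial.T k) =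
      LaurentPolynomial.C ((k - j) * (a * b)) * LaurentPolynomial.T (j + k) := by
  simp only [wittBracket_apply, eulerD_C_mul_T, LaurentPolynomial.T_add, map_mul, map_sub]
  ring

theorem virCocycle_C_mul_T (a b : ℂ) (j k : ℤ) :
    virCocycle (LaurentPolynomial.C a * LaurentPolynomial.T j)
      (LaurentPolynomial.C b * LaurentPolynomial.T k) =
      if j + k = 0 then ((j : ℂ) ^ 3 - j) / 12 * (a * b) else 0 := by
  have h : (LaurentPolynomial.C (j * (j * (j * a))) * LaurentPolynomial.T j -
      LaurentPolynomial.C (j * a) * LaurentPolynomial.T j) *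
      (LaurentPolynomial.C b * LaurentPolynomial.T k) =
      LaurentPolynomial.C (((j : ℂ) ^ 3 - j) * (a * b)) * LaurentPolynomial.T (j + k) := by
    simp only [LaurentPolynomial.T_add, map_mul, map_sub, map_pow]
    ring
  simp only [virCocycle, LinearMap.mk₂_apply, eulerD_C_mul_T]
  rw [h, constCoeff_C_mul_T]
  split_ifs <;> ring

theorem virCocycle_self (f : ℂ[T;T⁻¹]) : virCocycle f f = 0 := by
  have key : ∀ f g : ℂ[T;T⁻¹], virCocycle f g = - virCocycle g f := by
    intro f g
    induction f using LaurentPolynomial.induction_on' with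
    | add p q hp hq => simp only [map_add, LinearMap.add_apply, hp, hq]; ring
    | C_mul_T n a =>
      induction g using LaurentPolynomial.induction_on' with
      | add p q hp hq => simp only [map_add, LinearMap.add_apply, hp, hq]; ring
      | C_mul_T m b =>
        simp only [virCocycle_C_mul_T, add_comm m n]
        split_ifs with h
        · have : m = -n := by omega
          subst this; push_cast; ring
        · simp
  exact self_eq_neg.mp (key f f)

theorem wittBracket_leibniz (f g h : ℂ[T;T⁻¹]) :
    wittBracket f (wittBracket g h) =
      wittBracket (wittBracket f g) h + wittBracket g (wittBracket f h) := by
  simp only [wittBracket_apply, map_sub eulerD, eulerD_mul]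
  ring

theorem virCocycle_leibniz (f g h : ℂ[T;T⁻¹]) :
    virCocycle f (wittBracket g h) =
      virCocycle (wittBracket f g) h + virCocycle g (wittBracket f h) := by
  induction f using LaurentPolynomial.induction_on' with
  | add p q hp hq => simp only [map_add, LinearMap.add_apply, hp, hq]; ring
  | C_mul_T n a =>
    induction g using LaurentPolynomial.induction_on' with
    | add p q hp hq => simp only [map_add, LinearMap.add_apply, hp, hq]; ring
    | C_mul_T m b =>
      induction h using LaurentPolynomial.induction_on' with
      | add p q hp hq => simp only [map_add, hp, hq]; ring
      | C_mul_T l c =>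
        simp only [wittBracket_C_mul_T, virCocycle_C_mul_T,
          show n + m + l = n + (m + l) by ring, show m + (n + l) = n + (m + l) by ring]
        split_ifs with h0
        · have : l = -n - m := by omega
          subst this; push_cast; ring
        · simp

/-- The Virasoro algebra, as a vector space: the pair `(f, c)` stands for `∑ j, f_j e_j + c z`,
where `f = ∑ j, f_j t ^ j`. -/
def Virasoro : Type := ℂ[T;T⁻¹] × ℂ

namespace Virasoro

instance : AddCommGroup Virasoro := inferInstanceAs (AddCommGroup (ℂ[T;T⁻¹] × ℂ))

instance : Module ℂ Virasoro := inferInstanceAs (Module ℂ (ℂ[T;T⁻¹] × ℂ))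

/-- The projection `θ : Vir → ℂ[t, t⁻¹]`, with `e_j ↦ t ^ j` and `z ↦ 0`. -/
def theta : Virasoro →ₗ[ℂ] ℂ[T;T⁻¹] := LinearMap.fst ℂ ℂ[T;T⁻¹] ℂ

/-- The coefficient of the central element `z`. -/
def central : Virasoro →ₗ[ℂ] ℂ := LinearMap.snd ℂ ℂ[T;T⁻¹] ℂ

/-- The linear section `t ^ j ↦ e_j` of `theta`. -/
def ofLaurent : ℂ[T;T⁻¹] →ₗ[ℂ] Virasoro := LinearMap.inl ℂ ℂ[T;T⁻¹] ℂ

/-- The basis vector `e_j`. -/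
def e (j : ℤ) : Virasoro := ofLaurent (LaurentPolynomial.T j)

/-- The central element `z`. -/
def z : Virasoro := LinearMap.inr ℂ ℂ[T;T⁻¹] ℂ 1

@[ext] theorem ext {x y : Virasoro} (h₁ : theta x = theta y) (h₂ : central x = central y) :
    x = y := Prod.ext h₁ h₂

instance : Bracket Virasoro Virasoro :=
  ⟨fun x y => ofLaurent (wittBracket (theta x) (theta y)) +
    virCocycle (theta x) (theta y) • z⟩

@[simp] theorem theta_ofLaurent (f : ℂ[T;T⁻¹]) : theta (ofLaurent f) = f := rfl

@[simp] theorem central_ofLaurent (f : ℂ[T;T⁻¹]) : central (ofLaurent f) = 0 := rfl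

@[simp] theorem theta_z : theta z = 0 := rfl

@[simp] theorem central_z : central z = 1 := rfl

@[simp] theorem theta_lie (x y : Virasoro) :
    theta ⁅x, y⁆ = wittBracket (theta x) (theta y) := by
  change theta (ofLaurent _ + _ • z) = _
  simp

@[simp] theorem central_lie (x y : Virasoro) :
    central ⁅x, y⁆ = virCocycle (theta x) (theta y) := by
  change central (ofLaurent _ + _ • z) = _
  simp

instance : LieRing Virasoro where
  add_lie x y w := by ext1 <;> simp
  lie_add x y w := by ext1 <;> simp
  lie_self x := by
    ext1
    · simp [wittBracket_apply]
    · simp [virCocycle_self]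
  leibniz_lie x y w := by
    ext1
    · simp [wittBracket_leibniz (theta x) (theta y) (theta w)]
    · simp [virCocycle_leibniz (theta x) (theta y) (theta w)]

instance : LieAlgebra ℂ Virasoro where
  lie_smul c x y := by ext1 <;> simp

/-- The defining relations of the Virasoro algebra. -/
theorem lie_e_e (j k : ℤ) :
    ⁅e j, e k⁆ = ((k : ℂ) - j) • e (j + k) +
      (if k = -j then ((j : ℂ) ^ 3 - j) / 12 else 0) • z := by
  have h1 : ∀ n : ℤ, (LaurentPolynomial.T n : ℂ[T;T⁻¹]) =
      LaurentPolynomial.C 1 * LaurentPolynomial.T n := by intro n; simp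
  have h2 : (k = -j) ↔ (j + k = 0) := by omega
  ext1
  · simp only [e, theta_lie, theta_ofLaurent, map_add, map_smul, theta_z, smul_zero, add_zero]
    rw [h1 j, h1 k, wittBracket_C_mul_T, LaurentPolynomial.smul_eq_C_mul]
    simp
  · simp only [e, central_lie, theta_ofLaurent, map_add, map_smul, central_ofLaurent, smul_zero,
      zero_add, central_z, h2]
    rw [h1 j, h1 k, virCocycle_C_mul_T]
    simp

theorem lie_z_e (j : ℤ) : ⁅z, e j⁆ = 0 := by
  ext1 <;> simp

/-- The polynomial subalgebra `Vir^f = θ⁻¹(⟨f⟩)`, where `⟨f⟩` is the ideal of `ℂ[t, t⁻¹]`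
generated by `f`. -/
def polySubalgebra (f : ℂ[T;T⁻¹]) : LieSubalgebra ℂ Virasoro where
  carrier := {x | theta x ∈ Ideal.span {f}}
  add_mem' hx hy := by
    simp only [Set.mem_ofPred_eq, map_add] at *
    exact Ideal.add_mem _ hx hy
  zero_mem' := by simp
  smul_mem' c x hx := by
    simp only [Set.mem_ofPred_eq, map_smul, LaurentPolynomial.smul_eq_C_mul] at *
    exact Ideal.mul_mem_left _ _ hx
  lie_mem' {x y} hx hy := by
    change theta ⁅x, y⁆ ∈ Ideal.span {f}
    rw [theta_lie, wittBracket_apply]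
    exact Ideal.sub_mem _ (Ideal.mul_mem_right _ _ hx) (Ideal.mul_mem_right _ _ hy)

theorem mem_polySubalgebra {f : ℂ[T;T⁻¹]} {x : Virasoro} :
    x ∈ polySubalgebra f ↔ theta x ∈ Ideal.span {f} := Iff.rfl

/-- The element `x_j^f = ∑ i, a_i e_{j + i}` of `Vir^f`, where `f = ∑ i, a_i t ^ i`; it is the lift
of `t ^ j f` without `z`-component. -/
def polyElt (f : ℂ[T;T⁻¹]) (j : ℤ) : polySubalgebra f :=
  ⟨ofLaurent (LaurentPolynomial.T j * f),
    Ideal.mul_mem_left _ _ (Ideal.subset_span (Set.mem_singleton f))⟩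

/-- The Laurent polynomial `(t - a) ^ n`. -/
def linPow (a : ℂ) (n : ℕ) : ℂ[T;T⁻¹] := (LaurentPolynomial.T 1 - LaurentPolynomial.C a) ^ n

end Virasoro

/-! ### Induced modules -/

section Induced

variable {R L : Type*} [CommRing R] [LieRing L] [LieAlgebra R L]

/-- The `U(L)`-submodule of `U(L) ⊗_R R` spanned by the relations `u y ⊗ c = u ⊗ χ(y) c`, for `y`
in the subalgebra `H`. -/
def inducedRel (H : LieSubalgebra R L) (χ : LieAlgebra.LieCharacter R H) :
    Submodule (UniversalEnvelopingAlgebra R L) (UniversalEnvelopingAlgebra R L ⊗[R] R) :=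
  Submodule.span _ {w | ∃ (u : UniversalEnvelopingAlgebra R L) (y : H) (c : R),
    w = (u * UniversalEnvelopingAlgebra.ι R (y : L)) ⊗ₜ[R] c - u ⊗ₜ[R] (χ y * c)}

/-- The induced module `U(L) ⊗_{U(H)} R_χ`, where `R_χ` is the one-dimensional `H`-module on which
`H` acts through the character `χ`. As `U(H)` is generated by `H`, this balanced tensor product is
the quotient of `U(L) ⊗_R R` by the relations `u y ⊗ c = u ⊗ χ(y) c`, `y ∈ H`. -/
def InducedModule (H : LieSubalgebra R L) (χ : LieAlgebra.LieCharacter R H) : Type _ :=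
  (UniversalEnvelopingAlgebra R L ⊗[R] R) ⧸ inducedRel H χ

namespace InducedModule

variable (H : LieSubalgebra R L) (χ : LieAlgebra.LieCharacter R H)

instance : AddCommGroup (InducedModule H χ) :=
  inferInstanceAs (AddCommGroup ((UniversalEnvelopingAlgebra R L ⊗[R] R) ⧸ inducedRel H χ))

instance : Module (UniversalEnvelopingAlgebra R L) (InducedModule H χ) :=
  inferInstanceAs (Module (UniversalEnvelopingAlgebra R L)
    ((UniversalEnvelopingAlgebra R L ⊗[R] R) ⧸ inducedRel H χ))

instance : Module R (InducedModule H χ) :=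
  inferInstanceAs (Module R ((UniversalEnvelopingAlgebra R L ⊗[R] R) ⧸ inducedRel H χ))

instance : IsScalarTower R (UniversalEnvelopingAlgebra R L) (InducedModule H χ) :=
  inferInstanceAs (IsScalarTower R (UniversalEnvelopingAlgebra R L)
    ((UniversalEnvelopingAlgebra R L ⊗[R] R) ⧸ inducedRel H χ))

instance : LieRingModule L (InducedModule H χ) where
  bracket x v := UniversalEnvelopingAlgebra.ι R x • v
  add_lie x y v := by rw [map_add, add_smul]
  lie_add x v w := smul_add _ _ _
  leibniz_lie x y v := by
    let _ : LieRing (UniversalEnvelopingAlgebra R L) := LieRing.ofAssociativeRing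
    rw [LieHom.map_lie, LieRing.of_associative_ring_bracket, sub_smul, mul_smul, mul_smul]
    abel

theorem lie_def (x : L) (v : InducedModule H χ) :
    ⁅x, v⁆ = UniversalEnvelopingAlgebra.ι R x • v := rfl

instance : LieModule R L (InducedModule H χ) where
  smul_lie c x v := by rw [lie_def, map_smul, smul_assoc, lie_def]
  lie_smul c x v := by
    rw [lie_def, lie_def, ← algebraMap_smul (UniversalEnvelopingAlgebra R L) c v,
      ← algebraMap_smul (UniversalEnvelopingAlgebra R L) c (UniversalEnvelopingAlgebra.ι R x • v),
      smul_smul, smul_smul, Algebra.commutes]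

end InducedModule

end Induced

/-! ### Finite tensor products of Lie modules -/

section PiTensor

variable {R L ι : Type*} [CommRing R] [LieRing L] [LieAlgebra R L] [Fintype ι] [DecidableEq ι]
  {M : ι → Type*} [∀ i, AddCommGroup (M i)] [∀ i, Module R (M i)]
  [∀ i, LieRingModule L (M i)] [∀ i, LieModule R L (M i)]

variable (R M) in
/-- The action `∑ i, 1 ⊗ ⋯ ⊗ x ⊗ ⋯ ⊗ 1` (with `x` in position `i`) of `x` on a tensor product of
Lie modules. -/
def piTensorAction (x : L) : Module.End R (⨂[R] i, M i) :=
  ∑ i, PiTensorProduct.mapMonoidHom (Pi.mulSingle i (LieModule.toEnd R L (M i) x))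

theorem piTensorAction_tprod (x : L) (m : ∀ i, M i) :
    piTensorAction R M x (PiTensorProduct.tprod R m) =
      ∑ i, PiTensorProduct.tprod R (Function.update m i ⁅x, m i⁆) := by
  simp only [piTensorAction, LinearMap.sum_apply]
  refine Finset.sum_congr rfl fun i _ => ?_
  change PiTensorProduct.map _ _ = _
  rw [PiTensorProduct.map_tprod]
  congr 1
  funext j
  rcases eq_or_ne j i with rfl | h
  · simp
  · simp [h]

theorem piTensorAction_add (x y : L) :
    piTensorAction R M (x + y) = piTensorAction R M x + piTensorAction R M y := by
  refine PiTensorProduct.ext (MultilinearMap.ext fun m => ?_)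
  simp [piTensorAction_tprod, MultilinearMap.map_update_add, Finset.sum_add_distrib]

theorem piTensorAction_smul (c : R) (x : L) :
    piTensorAction R M (c • x) = c • piTensorAction R M x := by
  refine PiTensorProduct.ext (MultilinearMap.ext fun m => ?_)
  simp [piTensorAction_tprod, MultilinearMap.map_update_smul, Finset.smul_sum]

theorem mapMonoidHom_mulSingle_sub (i : ι) (f g : Module.End R (M i)) :
    PiTensorProduct.mapMonoidHom (R := R) (Pi.mulSingle i (f - g)) =
      PiTensorProduct.mapMonoidHom (Pi.mulSingle i f) -
        PiTensorProduct.mapMonoidHom (Pi.mulSingle i g) :=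
  (PiTensorProduct.mapMultilinear R M M).map_update_sub 1 i f g

theorem piTensorAction_lie (x y : L) :
    piTensorAction R M ⁅x, y⁆ =
      piTensorAction R M x * piTensorAction R M y - piTensorAction R M y * piTensorAction R M x := by
  simp only [piTensorAction, Finset.sum_mul_sum, LieHom.map_lie]
  rw [Finset.sum_comm (f := fun i j => PiTensorProduct.mapMonoidHom
    (Pi.mulSingle i (LieModule.toEnd R L (M i) y)) * PiTensorProduct.mapMonoidHom
    (Pi.mulSingle j (LieModule.toEnd R L (M j) x))), ← Finset.sum_sub_distrib]
  refine Finset.sum_congr rfl fun i _ => ?_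
  rw [← Finset.sum_sub_distrib, Finset.sum_eq_single i]
  · change PiTensorProduct.mapMonoidHom (Pi.mulSingle i (LieModule.toEnd R L (M i) x *
      LieModule.toEnd R L (M i) y - LieModule.toEnd R L (M i) y * LieModule.toEnd R L (M i) x)) = _
    rw [mapMonoidHom_mulSingle_sub, Pi.mulSingle_mul, Pi.mulSingle_mul, map_mul, map_mul]
  · intro j _ hj
    rw [← map_mul, ← map_mul, sub_eq_zero]
    exact congrArg _ (Pi.mulSingle_commute hj.symm _ _)
  · simp

instance : LieRingModule L (⨂[R] i, M i) where
  bracket x v := piTensorAction R M x v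
  add_lie x y v := by rw [piTensorAction_add]; rfl
  lie_add x v w := map_add _ v w
  leibniz_lie x y v := by
    rw [piTensorAction_lie]
    simp

instance : LieModule R L (⨂[R] i, M i) where
  smul_lie c x v := by
    change piTensorAction R M (c • x) v = c • piTensorAction R M x v
    rw [piTensorAction_smul]; rfl
  lie_smul c x v := map_smul (piTensorAction R M x) c v

theorem lie_tprod (x : L) (m : ∀ i, M i) :
    ⁅x, PiTensorProduct.tprod R m⁆ =
      ∑ i, PiTensorProduct.tprod R (Function.update m i ⁅x, m i⁆) :=
  piTensorAction_tprod x m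

end PiTensor

/-! ### The notions of the theorem -/

namespace Virasoro

/-- A `Vir`-module `V` is `Vir⁺`-locally annihilated if each vector is killed by all `e_j` with `j`
large enough. -/
def IsLocallyAnnihilated (V : Type*) [AddCommGroup V] [LieRingModule Virasoro V] : Prop :=
  ∀ v : V, ∃ N : ℕ, ∀ j : ℤ, (N : ℤ) ≤ j → ⁅e j, v⁆ = 0

/-- The polynomial `p` is associated to the homomorphism `μ : Vir^{(t - a)^n} → ℂ` if
`μ(t ^ j (t - a) ^ n) = p(j) a ^ j` for all integers `j`. -/
def IsAssociated {a : ℂ} {n : ℕ} (μ : LieAlgebra.LieCharacter ℂ (polySubalgebra (linPow a n)))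
    (p : Polynomial ℂ) : Prop :=
  ∀ j : ℤ, μ (polyElt (linPow a n) j) = p.eval (j : ℂ) * a ^ j

/-- The homomorphism `μ` has degree `r` if the polynomial associated to it has degree `r`, where the
zero polynomial has degree `-1`. -/
def HasDegree {a : ℂ} {n : ℕ} (μ : LieAlgebra.LieCharacter ℂ (polySubalgebra (linPow a n)))
    (r : ℤ) : Prop :=
  ∃ p : Polynomial ℂ, IsAssociated μ p ∧ r = if p = 0 then -1 else (p.natDegree : ℤ)

/-- The module `V_μ^{(t - a)^n} = U(Vir) ⊗_{U(Vir^{(t - a)^n})} ℂ_μ`. -/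
abbrev InducedVir {a : ℂ} {n : ℕ}
    (μ : LieAlgebra.LieCharacter ℂ (polySubalgebra (linPow a n))) : Type :=
  InducedModule (polySubalgebra (linPow a n)) μ

end Virasoro

end

/-! Identify `e_j` with the field t^(j+1) d/dt. The fields vanishing to order b at a point λ form a
subalgebra G b, and w_b = (t - λ)^b d/dt spans G b modulo G (b + 1). A vector of an induced module
is killed by some G M at its point, and a vector of V by all `e_j` with j large. Given a tensor u,
the Chinese remainder theorem then yields an element of Vir acting on u exactly as a prescribed x
acts on one chosen factor (`exists_lie_eq_factorAct`). Hence submodules of the tensor product are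
stable under each factor separately, and simplicity can be tested one factor at a time.

For one induced factor, the character kills z and G (2n), and multiplication by t - λ acts on its
polynomial p as a forward difference. So a nonzero character of degree r has order of vanishing m =
n + r + 1, and the condition r ≥ n - 2 reads m ≥ 2n - 1.

Under this condition every nonzero submodule is brought down to the generator
(`exists_mem_of_stable`). If m ≥ 3, then w_(m-b) acts by a scalar on what G (b + 1) generates. Its
bracket with w_b is (2b - m) w_(m-1) up to terms vanishing further, and is injective there because
2b < m for b < n. So w_(m-b) minus its scalar lowers the degree in w_b by exactly one, which removes
w_0, then w_1, up to w_(n-1). For m = 2 explicit formulas for w_2 and w_3 do the same.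

Conversely, if the character is zero or r < n - 2, it extends to a character of G (n - 1), because
[G (n-1), G (n-1)] lies in G (2n - 2). Letting G (n - 1) act on the generator by scalars then
defines a proper nonzero submodule (`exists_proper_submodule`). The nonvanishing statements come
from building induced representations by hand, one codimension at a time (`exists_extend`), in place
of the Poincaré–Birkhoff–Witt theorem. -/

/-! ### Filtrations of vector field type -/

/-- A decreasing filtration `G` of a Lie algebra, together with elements `w b ∈ G b`, which behaves
like the filtration of the vector fields on a line by the order of vanishing at a point, where `w b`
plays the role of `s ^ b d/ds`. -/
structure IsVectorFieldFiltration {K L : Type*} [Field K] [LieRing L] [LieAlgebra K L]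
    (G : ℕ → Submodule K L) (w : ℕ → L) : Prop where
  zero : G 0 = ⊤
  succ_le : ∀ b, G (b + 1) ≤ G b
  mem : ∀ b, w b ∈ G b
  notMem : ∀ b, w b ∉ G (b + 1)
  split : ∀ b, ∀ x ∈ G b, ∃ c : K, x - c • w b ∈ G (b + 1)
  lie_mem : ∀ a b, ∀ x ∈ G a, ∀ y ∈ G b, ⁅x, y⁆ ∈ G (a + b - 1)
  -- Quantifying over `M` makes this an equality modulo the intersection of all `G M`, which for the
  -- Virasoro algebra is the line spanned by `z`.
  lie_w : ∀ a b M, 1 ≤ a + b → ⁅w a, w b⁆ - ((b : K) - a) • w (a + b - 1) ∈ G M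

namespace IsVectorFieldFiltration

variable {K L : Type*} [Field K] [LieRing L] [LieAlgebra K L]
  {G : ℕ → Submodule K L} {w : ℕ → L}

theorem anti (h : IsVectorFieldFiltration G w) : Antitone G := antitone_nat_of_succ_le h.succ_le

theorem lie_mem_of_le (h : IsVectorFieldFiltration G w) {a b c : ℕ} (hc : c ≤ a + b - 1) {x y : L}
    (hx : x ∈ G a) (hy : y ∈ G b) : ⁅x, y⁆ ∈ G c :=
  h.anti hc (h.lie_mem a b x hx y hy)

/-- The leading terms of `x` and `y` are multiples of the same `w b` and commute, which gains one
order over `lie_mem`. This gain puts the threshold for simplicity at 2n - 2. -/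
theorem lie_mem_two_mul (h : IsVectorFieldFiltration G w) {b : ℕ} {x y : L} (hx : x ∈ G b)
    (hy : y ∈ G b) : ⁅x, y⁆ ∈ G (2 * b) := by
  obtain ⟨c, hc⟩ := h.split b x hx
  obtain ⟨d, hd⟩ := h.split b y hy
  have e : ⁅x, y⁆ = ⁅x - c • w b, y⁆ + c • ⁅w b, y - d • w b⁆ := by
    simp only [sub_lie, lie_sub, smul_lie, lie_smul, lie_self, smul_zero, sub_zero]
    abel
  rw [e]
  exact Submodule.add_mem _ (h.lie_mem_of_le (by omega) hc hy)
    (Submodule.smul_mem _ _ (h.lie_mem_of_le (by omega) (h.mem b) hd))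

theorem lie_mem_self (h : IsVectorFieldFiltration G w) {b : ℕ} {x y : L} (hx : x ∈ G b)
    (hy : y ∈ G b) : ⁅x, y⁆ ∈ G b :=
  h.anti (by omega) (h.lie_mem_two_mul hx hy)

end IsVectorFieldFiltration

/-! ### Spans of powers of an operator -/

section PowSpan

variable {K X : Type*} [Field K] [AddCommGroup X] [Module K X]

/-- The subspace `∑_{j < k} W ^ j Y`. -/
def powSpan (W : Module.End K X) (Y : Submodule K X) : ℕ → Submodule K X
  | 0 => ⊥
  | k + 1 => powSpan W Y k ⊔ Y.map (W ^ k)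

variable {W : Module.End K X} {Y : Submodule K X}

theorem powSpan_mono : Monotone (powSpan W Y) := monotone_nat_of_le_succ fun _ => le_sup_left

theorem pow_apply_mem_powSpan {j k : ℕ} (hjk : j < k) {x : X} (hx : x ∈ Y) :
    (W ^ j) x ∈ powSpan W Y k :=
  powSpan_mono (Nat.succ_le_of_lt hjk) (Submodule.mem_sup_right ⟨x, hx, rfl⟩)

theorem powSpan_le {S : Submodule K X} {k : ℕ} (h : ∀ j < k, ∀ x ∈ Y, (W ^ j) x ∈ S) :
    powSpan W Y k ≤ S := by
  induction k with
  | zero => exact bot_le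
  | succ k ih =>
    refine sup_le (ih fun j hj => h j (by omega)) ?_
    rintro _ ⟨x, hx, rfl⟩
    exact h k (by omega) x hx

theorem apply_mem_powSpan {k : ℕ} {u : X} (hu : u ∈ powSpan W Y k) : W u ∈ powSpan W Y (k + 1) := by
  refine (powSpan_le (S := (powSpan W Y (k + 1)).comap W) fun j hj x hx => ?_) hu
  rw [Submodule.mem_comap, ← Module.End.mul_apply, ← pow_succ']
  exact pow_apply_mem_powSpan (by omega) hx

theorem exists_leading_of_mem_powSpan {k : ℕ} {u : X} (hu : u ∈ powSpan W Y k) (hu0 : u ≠ 0) :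
    ∃ j, ∃ x ∈ Y, x ≠ 0 ∧ ∃ f ∈ powSpan W Y j, u = (W ^ j) x + f := by
  induction k with
  | zero => exact absurd ((Submodule.mem_bot K).mp hu) hu0
  | succ k ih =>
    obtain ⟨f, hf, _, ⟨x, hx, rfl⟩, rfl⟩ := Submodule.mem_sup.mp hu
    rcases eq_or_ne x 0 with rfl | hx0
    · have e : f + (W ^ k) 0 = f := by simp
      exact ih (by rwa [e])
    · exact ⟨k, x, hx, hx0, f, hf, add_comm _ _⟩

theorem mem_iSup_powSpan {u : X} : u ∈ ⨆ k, powSpan W Y k ↔ ∃ k, u ∈ powSpan W Y k :=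
  Submodule.mem_iSup_of_directed _ powSpan_mono.directed_le

end PowSpan

/-! ### Operators of a Lie algebra on spans of powers -/

section Lowering

variable {K L X : Type*} [Field K] [LieRing L] [LieAlgebra K L] [AddCommGroup X] [Module K X]
  (ρ : L →ₗ[K] Module.End K X)

/-- The linear map `ρ` is a representation of the Lie algebra `L`. -/
def IsLieRep : Prop :=
  ∀ x y u, ρ ⁅x, y⁆ u = ρ x (ρ y u) - ρ y (ρ x u)

variable {ρ} in
theorem IsLieRep.comm (hρ : IsLieRep ρ) (x y : L) (u : X) :
    ρ x (ρ y u) = ρ y (ρ x u) + ρ ⁅x, y⁆ u := by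
  rw [hρ]; abel

/-- The subspace `N` is stable under the operators `ρ x`, `x ∈ H`. -/
def StableUnder (H : Submodule K L) (N : Submodule K X) : Prop :=
  ∀ x ∈ H, ∀ u ∈ N, ρ x u ∈ N

variable {ρ}

/-- Moving `y` past one factor `w` leaves a multiple of `w` plus an element of `H`, so operators
from `H` never raise the `w`-degree. -/
theorem lie_pow_apply_mem (hρ : IsLieRep ρ) {H : Submodule K L} {w : L} {Y : Submodule K X}
    (hH : ∀ y ∈ H, ∃ c : K, ⁅y, w⁆ - c • w ∈ H) (hY : StableUnder ρ H Y) (k : ℕ) :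
    ∀ y ∈ H, ∀ x ∈ Y, ρ y ((ρ w ^ k) x) ∈ powSpan (ρ w) Y (k + 1) := by
  induction k with
  | zero => exact fun y hy x hx => pow_apply_mem_powSpan (W := ρ w) Nat.one_pos (hY y hy x hx)
  | succ k ih =>
    intro y hy x hx
    obtain ⟨c, hc⟩ := hH y hy
    rw [pow_succ', Module.End.mul_apply, hρ.comm,
      show ⁅y, w⁆ = (⁅y, w⁆ - c • w) + c • w by abel, map_add, map_smul, LinearMap.add_apply,
      LinearMap.smul_apply]
    refine Submodule.add_mem _ (apply_mem_powSpan (ih y hy x hx)) (Submodule.add_mem _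
      (powSpan_mono (by omega) (ih _ hc x hx)) (Submodule.smul_mem _ _ ?_))
    exact apply_mem_powSpan (pow_apply_mem_powSpan (by omega) hx)

theorem StableUnder.powSpan {H : Submodule K L} {w : L} {Y : Submodule K X}
    (hY : StableUnder ρ H Y) (hρ : IsLieRep ρ) (hH : ∀ y ∈ H, ∃ c : K, ⁅y, w⁆ - c • w ∈ H) (k : ℕ) :
    StableUnder ρ H (powSpan (ρ w) Y k) := by
  intro y hy u hu
  refine (powSpan_le (S := (_root_.powSpan (ρ w) Y k).comap (ρ y)) fun j hj x hx => ?_) hu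
  exact powSpan_mono (by omega) (lie_pow_apply_mem hρ hH hY j y hy x hx)

/-- When `⁅y, w⁆` stays in `H`, each commutation of `y` with `w` costs a factor `w`: only terms of
lower degree appear. -/
theorem lie_pow_apply_sub_mem (hρ : IsLieRep ρ) {H : Submodule K L} {w : L} {Y : Submodule K X}
    (hH : ∀ y ∈ H, ∃ c : K, ⁅y, w⁆ - c • w ∈ H) (hY : StableUnder ρ H Y) {y : L}
    (hyw : ⁅y, w⁆ ∈ H) {x : X} (hx : x ∈ Y) (k : ℕ) :
    ρ y ((ρ w ^ k) x) - (ρ w ^ k) (ρ y x) ∈ powSpan (ρ w) Y k := by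
  induction k with
  | zero => simp
  | succ k ih =>
    rw [pow_succ', Module.End.mul_apply, Module.End.mul_apply, hρ.comm,
      add_sub_right_comm, ← map_sub]
    exact Submodule.add_mem _ (apply_mem_powSpan ih) (lie_pow_apply_mem hρ hH hY k _ hyw x hx)

/-- Leibniz rule: commuting `d` past the `k + 1` factors `w` leaves `⁅d, w⁆` once in each place, and
`⁅d, w⁆` moves to the right up to lower degree because `⁅⁅d, w⁆, w⁆` is in `H`. -/
theorem lowering_pow_apply (hρ : IsLieRep ρ) {H : Submodule K L} {w d : L} {Y : Submodule K X} {δ : K}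
    (hH : ∀ y ∈ H, ∃ c : K, ⁅y, w⁆ - c • w ∈ H) (hY : StableUnder ρ H Y)
    (hd : ∀ x ∈ Y, ρ d x = δ • x) (hqw : ⁅⁅d, w⁆, w⁆ ∈ H)
    {x : X} (hx : x ∈ Y) (k : ℕ) :
    ρ d ((ρ w ^ (k + 1)) x) - δ • (ρ w ^ (k + 1)) x - ((k : K) + 1) • (ρ w ^ k) (ρ ⁅d, w⁆ x) ∈
      powSpan (ρ w) Y k := by
  induction k with
  | zero =>
    have : ρ d (ρ w x) - δ • ρ w x - ρ ⁅d, w⁆ x = 0 := by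
      rw [hρ, hd x hx, map_smul]; abel
    simp [this]
  | succ k ih =>
    have e : ρ d ((ρ w ^ (k + 1 + 1)) x) - δ • (ρ w ^ (k + 1 + 1)) x -
        (((k + 1 : ℕ) : K) + 1) • (ρ w ^ (k + 1)) (ρ ⁅d, w⁆ x) =
        ρ w (ρ d ((ρ w ^ (k + 1)) x) - δ • (ρ w ^ (k + 1)) x -
          ((k : K) + 1) • (ρ w ^ k) (ρ ⁅d, w⁆ x)) +
        (ρ ⁅d, w⁆ ((ρ w ^ (k + 1)) x) - (ρ w ^ (k + 1)) (ρ ⁅d, w⁆ x)) := by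
      rw [pow_succ' _ (k + 1), Module.End.mul_apply, hρ.comm]
      simp only [map_sub, map_smul, pow_succ' _ k, Module.End.mul_apply, Nat.cast_add, Nat.cast_one]
      module
    rw [e]
    exact Submodule.add_mem _ (apply_mem_powSpan ih) (lie_pow_apply_sub_mem hρ hH hY hqw hx _)

theorem lowering_apply_mem (hρ : IsLieRep ρ) {H : Submodule K L} {w d : L} {Y : Submodule K X} {δ : K}
    (hH : ∀ y ∈ H, ∃ c : K, ⁅y, w⁆ - c • w ∈ H) (hY : StableUnder ρ H Y)
    (hd : ∀ x ∈ Y, ρ d x = δ • x) (hq : ⁅d, w⁆ ∈ H) (hqw : ⁅⁅d, w⁆, w⁆ ∈ H) {k : ℕ} {u : X}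
    (hu : u ∈ powSpan (ρ w) Y (k + 1)) : ρ d u - δ • u ∈ powSpan (ρ w) Y k := by
  refine (powSpan_le (S := (powSpan (ρ w) Y k).comap (ρ d - δ • 1)) fun j hj x hx => ?_) hu
  change ρ d ((ρ w ^ j) x) - δ • (ρ w ^ j) x ∈ powSpan (ρ w) Y k
  cases j with
  | zero => simp [hd x hx]
  | succ j =>
    rw [← sub_add_cancel (ρ d ((ρ w ^ (j + 1)) x) - δ • (ρ w ^ (j + 1)) x)
      (((j : K) + 1) • (ρ w ^ j) (ρ ⁅d, w⁆ x))]
    exact Submodule.add_mem _ (powSpan_mono (by omega) (lowering_pow_apply hρ hH hY hd hqw hx j))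
      (Submodule.smul_mem _ _ (pow_apply_mem_powSpan (by omega) (hY _ hq x hx)))

/-- If `d` lowers the `w`-degree, with an injective operator as leading coefficient, then a subspace
stable under `d` which meets `∑ j, w ^ j Y` meets `Y`. -/
theorem exists_mem_of_lowering [CharZero K] (hρ : IsLieRep ρ) {H : Submodule K L} {w d : L} {Y : Submodule K X}
    {δ : K} (hH : ∀ y ∈ H, ∃ c : K, ⁅y, w⁆ - c • w ∈ H) (hY : StableUnder ρ H Y)
    (hd : ∀ x ∈ Y, ρ d x = δ • x) (hq : ⁅d, w⁆ ∈ H) (hqw : ⁅⁅d, w⁆, w⁆ ∈ H)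
    (hinj : ∀ x ∈ Y, ρ ⁅d, w⁆ x = 0 → x = 0) {N : Submodule K X} (hN : ∀ u ∈ N, ρ d u ∈ N)
    {k : ℕ} {u : X} (hu : u ∈ powSpan (ρ w) Y k) (huN : u ∈ N) (hu0 : u ≠ 0) :
    ∃ y ∈ N, y ∈ Y ∧ y ≠ 0 := by
  obtain ⟨j, x, hx, hx0, f, hf, rfl⟩ := exists_leading_of_mem_powSpan hu hu0
  clear hu hu0 k
  induction j generalizing x f with
  | zero =>
    obtain rfl := (Submodule.mem_bot K).mp hf
    exact ⟨x, by simpa using huN, hx, hx0⟩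
  | succ j ih =>
    -- Apply `d - δ`: the new leading coefficient is `(j + 1) ⁅d, w⁆ x`, nonzero by injectivity and
    -- characteristic zero.
    refine ih (((j : K) + 1) • ρ ⁅d, w⁆ x) (Submodule.smul_mem _ _ (hY _ hq x hx))
      (smul_ne_zero (by exact_mod_cast j.succ_ne_zero) fun h => hx0 (hinj x hx h))
      _ (Submodule.add_mem _ (lowering_pow_apply hρ hH hY hd hqw hx j)
        (lowering_apply_mem hρ hH hY hd hq hqw hf)) ?_
    have : (ρ w ^ j) (((j : K) + 1) • ρ ⁅d, w⁆ x) +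
        (ρ d ((ρ w ^ (j + 1)) x) - δ • (ρ w ^ (j + 1)) x -
          ((j : K) + 1) • (ρ w ^ j) (ρ ⁅d, w⁆ x) + (ρ d f - δ • f)) =
        ρ d ((ρ w ^ (j + 1)) x + f) - δ • ((ρ w ^ (j + 1)) x + f) := by
      simp only [map_add, map_smul, smul_add]; abel
    rw [this]
    exact Submodule.sub_mem _ (hN _ huN) (Submodule.smul_mem _ _ huN)

variable (ρ) in
/-- The smallest subspace which contains `B` and is stable under `H`. -/
def stableClosure (H : Submodule K L) (B : Submodule K X) : Submodule K X :=
  sInf {S | B ≤ S ∧ StableUnder ρ H S}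

theorem le_stableClosure {H : Submodule K L} {B : Submodule K X} : B ≤ stableClosure ρ H B :=
  le_sInf fun _ h => h.1

theorem stableClosure_le {H : Submodule K L} {B S : Submodule K X} (hB : B ≤ S)
    (hS : StableUnder ρ H S) : stableClosure ρ H B ≤ S :=
  sInf_le ⟨hB, hS⟩

theorem stableUnder_stableClosure {H : Submodule K L} {B : Submodule K X} :
    StableUnder ρ H (stableClosure ρ H B) := by
  intro x hx u hu
  rw [stableClosure, Submodule.mem_sInf] at hu ⊢
  exact fun S hS => hS.2 x hx u (hu S hS)

/-- Since `H'` is contained in `H + K w`, all factors `w` can be collected on the left. This is the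
spanning half of a Poincaré–Birkhoff–Witt statement. -/
theorem stableClosure_le_iSup_powSpan (hρ : IsLieRep ρ) {H H' : Submodule K L} {w : L} {B : Submodule K X}
    (hH : ∀ y ∈ H, ∃ c : K, ⁅y, w⁆ - c • w ∈ H) (hH' : ∀ y ∈ H', ∃ c : K, y - c • w ∈ H) :
    stableClosure ρ H' B ≤ ⨆ k, powSpan (ρ w) (stableClosure ρ H B) k := by
  refine stableClosure_le (fun b hb => mem_iSup_powSpan.mpr
    ⟨1, pow_apply_mem_powSpan (W := ρ w) Nat.one_pos (le_stableClosure hb)⟩) fun y hy u hu => ?_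
  obtain ⟨k, hk⟩ := mem_iSup_powSpan.mp hu
  obtain ⟨c, hc⟩ := hH' y hy
  refine mem_iSup_powSpan.mpr ⟨k + 1, ?_⟩
  rw [show y = (y - c • w) + c • w by abel, map_add, map_smul, LinearMap.add_apply,
    LinearMap.smul_apply]
  exact Submodule.add_mem _ (powSpan_mono k.le_succ
    (stableUnder_stableClosure.powSpan hρ hH k _ hc u hk))
    (Submodule.smul_mem _ _ (apply_mem_powSpan hk))

end Lowering

/-! ### Bringing subrepresentations down to the generating space -/

namespace IsVectorFieldFiltration

variable {K L X : Type*} [Field K] [LieRing L] [LieAlgebra K L]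
  [AddCommGroup X] [Module K X] {G : ℕ → Submodule K L} {w : ℕ → L}
  {ρ : L →ₗ[K] Module.End K X}

theorem exists_lie_sub_smul_mem (h : IsVectorFieldFiltration G w) (b : ℕ) :
    ∀ y ∈ G (b + 1), ∃ c : K, ⁅y, w b⁆ - c • w b ∈ G (b + 1) := fun _ hy =>
  h.split b _ (h.lie_mem_of_le (by omega) hy (h.mem b))

/-- For `x ∈ G (m + 1 - b)` and `y ∈ G b` the bracket lies in `G m`, where `ν` vanishes. So the
joint eigenspace for `ν` of the operators in `G (m + 1 - b)` is stable under `G b`. -/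
theorem apply_eq_smul_of_mem_stableClosure (h : IsVectorFieldFiltration G w) (hρ : IsLieRep ρ)
    {ν : L →ₗ[K] K} {n m b : ℕ} (hb : 1 ≤ b) (hnb : n + b ≤ m + 1)
    (hνm : ∀ x ∈ G m, ν x = 0) {B : Submodule K X} (hB : ∀ x ∈ G n, ∀ u ∈ B, ρ x u = ν x • u)
    {x : L} (hx : x ∈ G (m + 1 - b)) {u : X} (hu : u ∈ stableClosure ρ (G b) B) :
    ρ x u = ν x • u := by
  let S : Submodule K X :=
    { carrier := {u | ∀ x ∈ G (m + 1 - b), ρ x u = ν x • u}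
      add_mem' := fun {u v} hu hv x hx => by rw [map_add, hu x hx, hv x hx, smul_add]
      zero_mem' := fun x _ => by simp
      smul_mem' := fun c u hu x hx => by rw [map_smul, hu x hx, smul_comm] }
  have hS : stableClosure ρ (G b) B ≤ S := by
    refine stableClosure_le (fun u hu x hx => hB x (h.anti (by omega) hx) u hu) ?_
    intro y hy u hu x hx
    have hxy : ⁅x, y⁆ ∈ G m := h.lie_mem_of_le (by omega) hx hy
    rw [hρ.comm, hu x hx, hu _ (h.anti (by omega) hxy), hνm _ hxy, zero_smul, add_zero, map_smul]
  exact hS hu x hx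

/-- The case of vanishing order at least `3` in `exists_mem_of_stable`. -/
theorem exists_mem_of_stable_of_three_le [CharZero K] (h : IsVectorFieldFiltration G w)
    (hρ : IsLieRep ρ) {ν : L →ₗ[K] K} {n m : ℕ} (hnm : n + 1 ≤ m) (hm : 2 * n ≤ m + 1)
    (hm3 : 3 ≤ m) (hνm : ∀ x ∈ G m, ν x = 0) (hν : ν (w (m - 1)) ≠ 0) {B : Submodule K X}
    (hB : ∀ x ∈ G n, ∀ u ∈ B, ρ x u = ν x • u) {b : ℕ} (hb : b ≤ n) :
    ∀ N : Submodule K X, StableUnder ρ (G b) N → ∀ u ∈ N, u ∈ stableClosure ρ (G b) B → u ≠ 0 →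
      ∃ y ∈ N, y ∈ B ∧ y ≠ 0 := by
  induction hb using Nat.decreasingInduction with
  | self =>
    intro N _ u huN hu hu0
    refine ⟨u, huN, stableClosure_le le_rfl (fun x hx v hv => ?_) hu, hu0⟩
    rw [hB x hx v hv]
    exact B.smul_mem _ hv
  | of_succ b hb ih =>
    intro N hN u huN hu hu0
    have hq : ⁅w (m - b), w b⁆ ∈ G (m - 1) := h.lie_mem_of_le (by omega) (h.mem _) (h.mem _)
    have hq' : ⁅w (m - b), w b⁆ - (2 * (b : K) - m) • w (m - 1) ∈ G m := by
      have := h.lie_w (m - b) b m (by omega)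
      rwa [Nat.cast_sub (by omega), Nat.sub_add_cancel (by omega),
        show (b : K) - (m - b) = 2 * b - m by ring] at this
    have hνq : ν ⁅w (m - b), w b⁆ ≠ 0 := by
      have := hνm _ hq'
      rw [map_sub, map_smul, sub_eq_zero] at this
      rw [this]
      refine smul_ne_zero (sub_ne_zero.mpr ?_) hν
      -- From `b < n` and `2 n ≤ m + 1` one gets `2 b < m`.
      exact_mod_cast (by omega : 2 * b ≠ m)
    have hsc : ∀ {x : L}, x ∈ G (m - b) → ∀ u ∈ stableClosure ρ (G (b + 1)) B,
        ρ x u = ν x • u := fun {x} hx u hu =>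
      h.apply_eq_smul_of_mem_stableClosure hρ (by omega) (by omega) hνm hB
        (by rwa [Nat.add_sub_add_right]) hu
    have hinj : ∀ x ∈ stableClosure ρ (G (b + 1)) B, ρ ⁅w (m - b), w b⁆ x = 0 → x = 0 := by
      intro x hx hx0
      rcases Nat.eq_zero_or_pos b with rfl | hb0
      -- For `b = 0` the element `q` is only in `G (m - 1)` and need not act by a scalar. Its kernel
      -- is stable under `G 1`, as `⁅q, y⁆` is a multiple of `q` modulo `G m`. If nonzero, the
      -- kernel would meet `B`, where `q` acts by `ν q ≠ 0`.
      · set q := ⁅w (m - 0), w 0⁆ with hqdef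
        by_contra hxne
        have hst : StableUnder ρ (G 1) (stableClosure ρ (G 1) B ⊓ LinearMap.ker (ρ q)) := by
          intro y hy u hu
          refine ⟨stableUnder_stableClosure y hy u hu.1, ?_⟩
          obtain ⟨c, hc⟩ := h.split 1 y hy
          have hu0 : ρ q u = 0 := hu.2
          have key : ⁅q, y⁆ - (c * (2 - m)) • q ∈ G m := by
            have e : ⁅q, y⁆ - (c * (2 - m)) • q = ⁅q, y - c • w 1⁆ +
                c • ⁅q - (2 * ((0 : ℕ) : K) - m) • w (m - 1), w 1⁆ +
                (c * (2 * ((0 : ℕ) : K) - m)) •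
                  (⁅w (m - 1), w 1⁆ - (((1 : ℕ) : K) - (m - 1 : ℕ)) • w (m - 1 + 1 - 1)) -
                (c * (2 - m)) • (q - (2 * ((0 : ℕ) : K) - m) • w (m - 1)) := by
              simp only [sub_lie, lie_sub, smul_lie, lie_smul, Nat.add_sub_cancel]
              rw [Nat.cast_sub (by omega)]
              push_cast
              module
            rw [e]
            refine Submodule.sub_mem _ (Submodule.add_mem _ (Submodule.add_mem _
              (h.lie_mem_of_le (by omega) hq hc) (Submodule.smul_mem _ _
              (h.lie_mem_of_le (by omega) hq' (h.mem 1)))) (Submodule.smul_mem _ _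
              (h.lie_w _ _ _ (by omega)))) (Submodule.smul_mem _ _ hq')
          have hk := hsc (by simpa using key) u hu.1
          rw [hνm _ key, zero_smul, map_sub, map_smul, LinearMap.sub_apply, LinearMap.smul_apply,
            hu0, smul_zero, sub_zero] at hk
          change ρ q (ρ y u) = 0
          rw [hρ.comm, hu0, hk, map_zero, add_zero]
        obtain ⟨y, hy, hyB, hy0⟩ := ih _ hst x ⟨hx, hx0⟩ hx hxne
        have := hB q (h.anti (by omega) hq) y hyB
        rw [show ρ q y = 0 from hy.2] at this
        exact smul_ne_zero hνq hy0 this.symm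
      · rw [hsc (h.anti (by omega) hq) x hx] at hx0
        exact (smul_eq_zero.mp hx0).resolve_left hνq
    obtain ⟨k, hk⟩ := mem_iSup_powSpan.mp
      (stableClosure_le_iSup_powSpan hρ (h.exists_lie_sub_smul_mem b) (h.split b) hu)
    obtain ⟨y, hyN, hy, hy0⟩ := exists_mem_of_lowering hρ (h.exists_lie_sub_smul_mem b)
      stableUnder_stableClosure (hsc (h.mem _)) (h.anti (by omega) hq)
      (h.lie_mem_of_le (by omega) hq (h.mem b)) hinj
      (fun v hv => hN _ (h.anti (by omega) (h.mem _)) v hv) hk huN hu0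
    exact ih N (fun x hx => hN x (h.succ_le b hx)) y hyN hy hy0

theorem w_one_pow_apply (h : IsVectorFieldFiltration G w) (hρ : IsLieRep ρ)
    (hker : ∀ x, (∀ M, x ∈ G M) → ρ x = 0) {κ : K} {x : X} (h1 : ρ (w 1) x = κ • x) (k : ℕ) :
    ρ (w 1) ((ρ (w 0) ^ k) x) = (κ - k) • (ρ (w 0) ^ k) x := by
  have e : ρ ⁅w 1, w 0⁆ = -ρ (w 0) := by
    have := hker _ fun M => h.lie_w 1 0 M (by omega)
    rw [map_sub, map_smul, sub_eq_zero] at this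
    simpa using this
  induction k with
  | zero => simpa using h1
  | succ k ih =>
    rw [pow_succ', Module.End.mul_apply, hρ.comm, ih, e, map_smul, LinearMap.neg_apply]
    push_cast
    module

/-- An `sl₂` computation with `w 0`, `w 1`, `w 2`. The coefficient vanishes when `k = 2 κ`, and `w
3` is needed to pass that degree. -/
theorem w_two_pow_apply (h : IsVectorFieldFiltration G w) (hρ : IsLieRep ρ)
    (hker : ∀ x, (∀ M, x ∈ G M) → ρ x = 0) {κ : K} {x : X} (h1 : ρ (w 1) x = κ • x)
    (h2 : ρ (w 2) x = 0) (k : ℕ) :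
    ρ (w 2) ((ρ (w 0) ^ (k + 1)) x) = ((k + 1) * (k - 2 * κ)) • (ρ (w 0) ^ k) x := by
  have e : ρ ⁅w 2, w 0⁆ = (-2 : K) • ρ (w 1) := by
    have := hker _ fun M => h.lie_w 2 0 M (by omega)
    rw [map_sub, map_smul, sub_eq_zero] at this
    simpa using this
  have step : ∀ k : ℕ, ρ (w 2) ((ρ (w 0) ^ (k + 1)) x) = ρ (w 0) (ρ (w 2) ((ρ (w 0) ^ k) x)) +
      (-2 * (κ - k)) • (ρ (w 0) ^ k) x := fun k => by
    rw [pow_succ', Module.End.mul_apply, hρ.comm, e, LinearMap.smul_apply,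
      h.w_one_pow_apply hρ hker h1, smul_smul]
  induction k with
  | zero =>
    rw [step, pow_zero, Module.End.one_apply, h2, map_zero]
    push_cast
    module
  | succ k ih =>
    rw [step, ih, map_smul, pow_succ', Module.End.mul_apply]
    push_cast
    module

theorem w_three_apply (h : IsVectorFieldFiltration G w) (hρ : IsLieRep ρ)
    (hker : ∀ x, (∀ M, x ∈ G M) → ρ x = 0) {x : X} (h2 : ρ (w 2) x = 0) (h3 : ρ (w 3) x = 0) :
    ρ (w 3) (ρ (w 0) x) = 0 := by
  have e : ρ ⁅w 3, w 0⁆ = (-3 : K) • ρ (w 2) := by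
    have := hker _ fun M => h.lie_w 3 0 M (by omega)
    rw [map_sub, map_smul, sub_eq_zero] at this
    simpa using this
  rw [hρ.comm, h3, e, LinearMap.smul_apply, h2]
  simp

theorem w_three_pow_apply (h : IsVectorFieldFiltration G w) (hρ : IsLieRep ρ)
    (hker : ∀ x, (∀ M, x ∈ G M) → ρ x = 0) {κ : K} {x : X} (h1 : ρ (w 1) x = κ • x)
    (h2 : ρ (w 2) x = 0) (h3 : ρ (w 3) x = 0) (k : ℕ) :
    ρ (w 3) ((ρ (w 0) ^ (k + 2)) x) =
      ((k + 2) * (k + 1) * (3 * κ - k)) • (ρ (w 0) ^ k) x := by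
  have e : ρ ⁅w 3, w 0⁆ = (-3 : K) • ρ (w 2) := by
    have := hker _ fun M => h.lie_w 3 0 M (by omega)
    rw [map_sub, map_smul, sub_eq_zero] at this
    simpa using this
  have step : ∀ k : ℕ, ρ (w 3) ((ρ (w 0) ^ (k + 2)) x) = ρ (w 0) (ρ (w 3) ((ρ (w 0) ^ (k + 1)) x)) +
      (-3 * ((k + 1) * (k - 2 * κ))) • (ρ (w 0) ^ k) x := fun k => by
    rw [pow_succ' _ (k + 1), Module.End.mul_apply, hρ.comm, e, LinearMap.smul_apply,
      h.w_two_pow_apply hρ hker h1 h2, smul_smul]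
  induction k with
  | zero =>
    rw [step, zero_add, pow_one, pow_zero, Module.End.one_apply, h.w_three_apply hρ hker h2 h3,
      map_zero]
    push_cast
    module
  | succ k ih =>
    rw [step, ih, map_smul, pow_succ' _ k, Module.End.mul_apply]
    push_cast
    module

/-- The case of vanishing order `2` in `exists_mem_of_stable`. -/
theorem exists_mem_of_stable_of_eq_two [CharZero K] (h : IsVectorFieldFiltration G w)
    (hρ : IsLieRep ρ) {ν : L →ₗ[K] K} (hν2 : ∀ x ∈ G 2, ν x = 0) (hν : ν (w 1) ≠ 0)
    {B : Submodule K X} (hB : ∀ x ∈ G 1, ∀ u ∈ B, ρ x u = ν x • u)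
    (hker : ∀ x, (∀ M, x ∈ G M) → ρ x = 0) {N : Submodule K X} (hN : StableUnder ρ ⊤ N) {k : ℕ}
    {u : X} (hu : u ∈ powSpan (ρ (w 0)) B k) (huN : u ∈ N) (hu0 : u ≠ 0) :
    ∃ y ∈ N, y ∈ B ∧ y ≠ 0 := by
  have h1 : ∀ x ∈ B, ρ (w 1) x = ν (w 1) • x := hB _ (h.mem 1)
  have h2 : ∀ x ∈ B, ρ (w 2) x = 0 := fun x hx => by
    rw [hB _ (h.succ_le 1 (h.mem 2)) x hx, hν2 _ (h.mem 2), zero_smul]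
  have h3 : ∀ x ∈ B, ρ (w 3) x = 0 := fun x hx => by
    rw [hB _ (h.anti (by omega : 1 ≤ 3) (h.mem 3)) x hx, hν2 _ (h.succ_le 2 (h.mem 3)), zero_smul]
  obtain ⟨j, x, hx, hx0, f, hf, rfl⟩ := exists_leading_of_mem_powSpan hu hu0
  clear hu hu0 k
  have low2 : ∀ j, ∀ f ∈ powSpan (ρ (w 0)) B (j + 1), ρ (w 2) f ∈ powSpan (ρ (w 0)) B j := by
    intro j f hf
    refine (powSpan_le (S := (powSpan (ρ (w 0)) B j).comap (ρ (w 2))) fun i hi x hx => ?_) hf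
    rw [Submodule.mem_comap]
    rcases i with _ | i
    · simp [h2 x hx]
    · rw [h.w_two_pow_apply hρ hker (h1 x hx) (h2 x hx)]
      exact Submodule.smul_mem _ _ (pow_apply_mem_powSpan (by omega) hx)
  have low3 : ∀ j, ∀ f ∈ powSpan (ρ (w 0)) B (j + 2), ρ (w 3) f ∈ powSpan (ρ (w 0)) B j := by
    intro j f hf
    refine (powSpan_le (S := (powSpan (ρ (w 0)) B j).comap (ρ (w 3))) fun i hi x hx => ?_) hf
    rw [Submodule.mem_comap]
    rcases i with _ | _ | i
    · simp [h3 x hx]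
    · simp [h.w_three_apply hρ hker (h2 x hx) (h3 x hx)]
    · rw [h.w_three_pow_apply hρ hker (h1 x hx) (h2 x hx) (h3 x hx)]
      exact Submodule.smul_mem _ _ (pow_apply_mem_powSpan (by omega) hx)
  induction j using Nat.strong_induction_on generalizing x f with
  | _ j ih =>
    rcases j with _ | j
    · obtain rfl := (Submodule.mem_bot K).mp hf
      exact ⟨x, by simpa using huN, hx, hx0⟩
    -- The leading degree is `j + 1`. Unless `j = 2 ν (w 1)`, `w 2` lowers it by one; otherwise `w
    -- 3` lowers it by two, its coefficient being nonzero since the two coefficients have no common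
    -- zero.
    by_cases hj : (j : K) - 2 * ν (w 1) = 0
    · rcases j with _ | j
      · exact absurd (by simpa using hj) hν
      refine ih j (by omega) ((((j : K) + 2) * (j + 1) * (3 * ν (w 1) - j)) • x)
        (B.smul_mem _ hx) (smul_ne_zero (mul_ne_zero (mul_ne_zero ?_ ?_) ?_) hx0) _
        (low3 j f hf) ?_
      · exact_mod_cast (by omega : j + 2 ≠ 0)
      · exact_mod_cast (by omega : j + 1 ≠ 0)
      · intro hj'
        push_cast at hj
        have : (j : K) + 3 = 0 := by linear_combination 3 * hj + 2 * hj'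
        exact absurd this (by exact_mod_cast (by omega : j + 3 ≠ 0))
      · rw [map_smul, ← h.w_three_pow_apply hρ hker (h1 x hx) (h2 x hx) (h3 x hx), ← map_add]
        exact hN _ trivial _ huN
    · refine ih j (by omega) ((((j : K) + 1) * (j - 2 * ν (w 1))) • x)
        (B.smul_mem _ hx) (smul_ne_zero (mul_ne_zero ?_ hj) hx0) _ (low2 j f hf) ?_
      · exact_mod_cast (by omega : j + 1 ≠ 0)
      · rw [map_smul, ← h.w_two_pow_apply hρ hker (h1 x hx) (h2 x hx), ← map_add]
        exact hN _ trivial _ huN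

/-- Let `H = G n` act on a subspace `B` through a linear form `ν` whose order of vanishing `m` is at
least `2 n - 1` and greater than `n`. Then every subrepresentation which meets the
subrepresentation generated by `B` also meets `B`. -/
theorem exists_mem_of_stable [CharZero K] (h : IsVectorFieldFiltration G w)
    (hρ : IsLieRep ρ) {ν : L →ₗ[K] K} {n m : ℕ} (hn : 1 ≤ n) (hnm : n + 1 ≤ m)
    (hm : 2 * n ≤ m + 1) (hνm : ∀ x ∈ G m, ν x = 0) (hν : ν (w (m - 1)) ≠ 0) {B : Submodule K X}
    (hB : ∀ x ∈ G n, ∀ u ∈ B, ρ x u = ν x • u) (hker : ∀ x, (∀ M, x ∈ G M) → ρ x = 0)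
    {N : Submodule K X} (hN : StableUnder ρ ⊤ N) {u : X} (huN : u ∈ N)
    (hu : u ∈ stableClosure ρ ⊤ B) (hu0 : u ≠ 0) : ∃ y ∈ N, y ∈ B ∧ y ≠ 0 := by
  rw [← h.zero] at hu
  rcases (show 3 ≤ m ∨ m = 2 by omega) with hm3 | rfl
  · exact h.exists_mem_of_stable_of_three_le hρ hnm hm hm3 hνm hν hB (Nat.zero_le n) N
      (by rwa [h.zero]) u huN hu hu0
  -- Here the general argument fails: `⁅w 2, w 0⁆` is `-2 w 1`, whose bracket with `w 0` is a
  -- multiple of `w 0` and leaves `G 1`.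
  · obtain rfl : n = 1 := by omega
    obtain ⟨k, hk⟩ := mem_iSup_powSpan.mp
      (stableClosure_le_iSup_powSpan hρ (h.exists_lie_sub_smul_mem 0) (h.split 0) hu)
    have hB1 : stableClosure ρ (G 1) B = B := le_antisymm
      (stableClosure_le le_rfl fun x hx v hv => by rw [hB x hx v hv]; exact B.smul_mem _ hv)
      le_stableClosure
    rw [zero_add, hB1] at hk
    exact h.exists_mem_of_stable_of_eq_two hρ hνm hν hB hker hN hk huN hu0

end IsVectorFieldFiltration

/-! ### Extending representations from a subalgebra of codimension one -/

section Extend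

variable {K L M : Type*} [Field K] [LieRing L] [LieAlgebra K L] [AddCommGroup M] [Module K M]

variable (K L M) in
/-- The shift `single k m ↦ single (k + 1) m` on `⨁_k M`. -/
noncomputable def shiftEnd : Module.End K (ℕ →₀ M) := Finsupp.lmapDomain M K Nat.succ

@[simp] theorem shiftEnd_single (k : ℕ) (m : M) :
    shiftEnd K M (Finsupp.single k m) = Finsupp.single (k + 1) m :=
  Finsupp.mapDomain_single

/-- The projection `x ↦ x - α x • w`. -/
noncomputable def projAlong (w : L) (α : L →ₗ[K] K) : L →ₗ[K] L := LinearMap.id - α.smulRight w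

theorem projAlong_apply (w : L) (α : L →ₗ[K] K) (x : L) : projAlong w α x = x - α x • w := rfl

/-- The action of `x` on `w ^ k ⊗ m`, where `w ^ k ⊗ m` is encoded as `single k m`. -/
noncomputable def extendAux (w : L) (α : L →ₗ[K] K) (ρ : L →ₗ[K] Module.End K M) :
    ℕ → L →ₗ[K] M →ₗ[K] (ℕ →₀ M)
  | 0 =>
    { toFun := fun x => α x • Finsupp.lsingle 1 + Finsupp.lsingle 0 ∘ₗ ρ (projAlong w α x)
      map_add' := fun x y => by simp only [map_add, LinearMap.comp_add]; module
      map_smul' := fun c x => by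
        simp only [map_smul, LinearMap.comp_smul, smul_eq_mul, RingHom.id_apply]; module }
  | k + 1 =>
    -- Split `x` as its projection plus `α x • w`. The projection `x'` is moved past one `w` by `x'
    -- w = w x' + ⁅x', w⁆`, and the recursion needs all elements of `L` at level `k` at once.
    { toFun := fun x => α x • Finsupp.lsingle (k + 2) +
        shiftEnd K M ∘ₗ extendAux w α ρ k (projAlong w α x) +
        extendAux w α ρ k ⁅projAlong w α x, w⁆
      map_add' := fun x y => by simp only [map_add, LinearMap.comp_add, add_lie]; module
      map_smul' := fun c x => by
        simp only [map_smul, LinearMap.comp_smul, smul_eq_mul, smul_lie, RingHom.id_apply]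
        module }

/-- The extension of a representation `ρ` on a subalgebra `H` to the subalgebra `H ⊕ K w`; the
underlying space is that of the induced representation. The form `α` vanishes on `H`, and
`α w = 1`. -/
noncomputable def extendRep (w : L) (α : L →ₗ[K] K) (ρ : L →ₗ[K] Module.End K M) :
    L →ₗ[K] Module.End K (ℕ →₀ M) :=
  (Finsupp.lsum K).toLinearMap ∘ₗ LinearMap.pi (extendAux w α ρ)

variable {w : L} {α : L →ₗ[K] K} {ρ : L →ₗ[K] Module.End K M}

theorem extendRep_single_zero (x : L) (m : M) :
    extendRep w α ρ x (Finsupp.single 0 m) =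
      α x • Finsupp.single 1 m + Finsupp.single 0 (ρ (projAlong w α x) m) := by
  simp [extendRep, extendAux]

theorem extendRep_single_succ (x : L) (k : ℕ) (m : M) :
    extendRep w α ρ x (Finsupp.single (k + 1) m) =
      α x • Finsupp.single (k + 2) m +
        shiftEnd K M (extendRep w α ρ (projAlong w α x) (Finsupp.single k m)) +
        extendRep w α ρ ⁅projAlong w α x, w⁆ (Finsupp.single k m) := by
  simp [extendRep, extendAux]

theorem projAlong_of_eq_zero {x : L} (hx : α x = 0) : projAlong w α x = x := by
  simp [projAlong_apply, hx]

theorem projAlong_self (hα : α w = 1) : projAlong w α w = 0 := by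
  simp [projAlong_apply, hα]

theorem extendRep_self (hα : α w = 1) : extendRep w α ρ w = shiftEnd K M := by
  refine Finsupp.lhom_ext fun k m => ?_
  rcases k with _ | k
  · simp [extendRep_single_zero, projAlong_self hα, hα]
  · simp [extendRep_single_succ, projAlong_self hα, hα]

/-- As `w` acts by the shift, this is the commutation relation of any `x` with `w`. It is built into
the recursion and holds without assumptions on `ρ`. -/
theorem extendRep_shiftEnd (hα : α w = 1) (x : L) (u : ℕ →₀ M) :
    extendRep w α ρ x (shiftEnd K M u) =
      shiftEnd K M (extendRep w α ρ x u) + extendRep w α ρ ⁅x, w⁆ u := by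
  have h : extendRep w α ρ x ∘ₗ shiftEnd K M =
      shiftEnd K M ∘ₗ extendRep w α ρ x + extendRep w α ρ ⁅x, w⁆ := by
    refine Finsupp.lhom_ext fun k m => ?_
    have e : x = projAlong w α x + α x • w := by rw [projAlong_apply]; abel
    have e1 : extendRep w α ρ x = extendRep w α ρ (projAlong w α x) + α x • shiftEnd K M := by
      conv_lhs => rw [e]
      rw [map_add, map_smul, extendRep_self hα]
    have e2 : ⁅x, w⁆ = ⁅projAlong w α x, w⁆ := by
      conv_lhs => rw [e]
      simp
    simp only [LinearMap.comp_apply, LinearMap.add_apply, shiftEnd_single, extendRep_single_succ]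
    rw [e2, e1]
    simp only [LinearMap.add_apply, LinearMap.smul_apply, map_add, map_smul, shiftEnd_single]
    abel
  exact LinearMap.congr_fun h u

/-- The linear map `ρ` is a representation when restricted to the subspace `H`. -/
noncomputable def IsLieRepOn (H : Submodule K L) (ρ : L →ₗ[K] Module.End K M) : Prop :=
  ∀ x ∈ H, ∀ y ∈ H, ∀ u, ρ ⁅x, y⁆ u = ρ x (ρ y u) - ρ y (ρ x u)

theorem isLieRepOn_extendRep {H H' : Submodule K L} (hH : ∀ x ∈ H, ∀ y ∈ H, ⁅x, y⁆ ∈ H)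
    (hH' : ∀ x ∈ H', ∀ y ∈ H', ⁅x, y⁆ ∈ H') (hw : w ∈ H') (hα : α w = 1)
    (hαH : ∀ x ∈ H, α x = 0) (hproj : ∀ x ∈ H', projAlong w α x ∈ H)
    (hρ : IsLieRepOn H ρ) : IsLieRepOn H' (extendRep w α ρ) := by
  set σ := extendRep w α ρ with hσ
  have hcomm : ∀ x u, σ x (shiftEnd K M u) = shiftEnd K M (σ x u) + σ ⁅x, w⁆ u :=
    extendRep_shiftEnd hα
  -- By bilinearity, and since `hcomm` covers brackets with `w`, the identity at a given vector need
  -- only be checked on `H`. In degree zero it is the hypothesis on `ρ`; the Jacobi identity carries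
  -- it through each shift.
  have hred : ∀ u, (∀ x ∈ H, ∀ y ∈ H, σ ⁅x, y⁆ u = σ x (σ y u) - σ y (σ x u)) →
      ∀ x ∈ H', ∀ y ∈ H', σ ⁅x, y⁆ u = σ x (σ y u) - σ y (σ x u) := by
    intro u hu x hx y hy
    have hx' : x = projAlong w α x + α x • w := by rw [projAlong_apply]; abel
    have hy' : y = projAlong w α y + α y • w := by rw [projAlong_apply]; abel
    have h1 := hu _ (hproj x hx) _ (hproj y hy)
    have h2 := hcomm (projAlong w α x) u
    have h3 := hcomm (projAlong w α y) u
    generalize projAlong w α x = x' at hx' h1 h2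
    generalize projAlong w α y = y' at hy' h1 h3
    have hsw : σ w = shiftEnd K M := extendRep_self hα
    rw [hx', hy']
    simp only [lie_add, add_lie, smul_lie, lie_smul, lie_self, map_add, map_smul, LinearMap.add_apply,
      LinearMap.smul_apply, hsw, h1, h2, h3, ← lie_skew y' w, map_neg, LinearMap.neg_apply]
    simp only [smul_add, smul_neg, smul_zero, map_zero, LinearMap.zero_apply]
    module
  have hsingle : ∀ k m, ∀ x ∈ H', ∀ y ∈ H', σ ⁅x, y⁆ (Finsupp.single k m) =
      σ x (σ y (Finsupp.single k m)) - σ y (σ x (Finsupp.single k m)) := by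
    intro k m
    induction k with
    | zero =>
      have h0 : ∀ x ∈ H, ∀ m, σ x (Finsupp.single 0 m) = Finsupp.single 0 (ρ x m) := by
        intro x hx m
        rw [hσ, extendRep_single_zero, hαH x hx, projAlong_of_eq_zero (hαH x hx), zero_smul,
          zero_add]
      refine hred _ fun x hx y hy => ?_
      rw [h0 _ (hH x hx y hy), h0 x hx, h0 y hy, h0 x hx, h0 y hy, hρ x hx y hy,
        Finsupp.single_sub]
    | succ k ih =>
      intro x hx y hy
      rw [← shiftEnd_single (K := K)]
      simp only [hcomm, map_add, map_sub, ih x hx y hy]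
      rw [lie_lie x y w, map_sub, LinearMap.sub_apply, ih x hx _ (hH' y hy w hw),
        ih y hy _ (hH' x hx w hw)]
      abel
  intro x hx y hy u
  induction u using Finsupp.induction_linear with
  | zero => simp
  | add f g hf hg => simp only [map_add, hf, hg]; abel
  | single k m => exact hsingle k m x hx y hy

end Extend

/-! ### Extending representations from `G b` to the whole Lie algebra -/

namespace IsVectorFieldFiltration

variable {K L : Type*} [Field K] [LieRing L] [LieAlgebra K L]
  {G : ℕ → Submodule K L} {w : ℕ → L}

theorem exists_dual (h : IsVectorFieldFiltration G w) (b : ℕ) :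
    ∃ α : L →ₗ[K] K, α (w b) = 1 ∧ (∀ x ∈ G (b + 1), α x = 0) ∧
      ∀ x ∈ G b, projAlong (w b) α x ∈ G (b + 1) := by
  obtain ⟨f, hf, hle⟩ := Submodule.exists_le_ker_of_notMem (h.notMem b)
  have h1 : ((f (w b))⁻¹ • f) (w b) = 1 := inv_mul_cancel₀ hf
  have h2 : ∀ x ∈ G (b + 1), ((f (w b))⁻¹ • f) x = 0 := fun x hx => by
    rw [LinearMap.smul_apply, LinearMap.mem_ker.mp (hle hx), smul_zero]
  refine ⟨(f (w b))⁻¹ • f, h1, h2, fun x hx => ?_⟩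
  obtain ⟨c, hc⟩ := h.split b x hx
  have := h2 _ hc
  rw [map_sub, map_smul, h1, smul_eq_mul, mul_one, sub_eq_zero] at this
  rwa [projAlong_apply, this]

/-- One step of extending a representation, from `G (b + 1)` to `G b`. -/
theorem exists_extend_succ (h : IsVectorFieldFiltration G w) (b : ℕ) {M : Type*} [AddCommGroup M]
    [Module K M] (ρ : L →ₗ[K] Module.End K M) (hρ : IsLieRepOn (G (b + 1)) ρ) :
    ∃ σ : L →ₗ[K] Module.End K (ℕ →₀ M), IsLieRepOn (G b) σ ∧
      (∀ x ∈ G (b + 1), ∀ m, σ x (Finsupp.single 0 m) = Finsupp.single 0 (ρ x m)) ∧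
      ∀ m, σ (w b) (Finsupp.single 0 m) = Finsupp.single 1 m := by
  obtain ⟨α, h1, h2, h3⟩ := h.exists_dual b
  refine ⟨extendRep (w b) α ρ, isLieRepOn_extendRep (fun x hx y hy => h.lie_mem_self hx hy)
    (fun x hx y hy => h.lie_mem_self hx hy) (h.mem b) h1 h2 h3 hρ, ?_, fun m => ?_⟩
  · intro x hx m
    rw [extendRep_single_zero, h2 x hx, projAlong_of_eq_zero (h2 x hx), zero_smul, zero_add]
  · rw [extendRep_self h1, shiftEnd_single]

/-- The injectivity of `f` makes vectors of induced modules visibly nonzero: an induced module maps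
to `X` by its universal property. -/
theorem exists_extend (h : IsVectorFieldFiltration G w) (b : ℕ) :
    ∀ (M : Type) [AddCommGroup M] [Module K M] (ρ : L →ₗ[K] Module.End K M),
      IsLieRepOn (G b) ρ → ∃ (X : Type) (_ : AddCommGroup X) (_ : Module K X)
        (σ : L →ₗ[K] Module.End K X) (f : M →ₗ[K] X), IsLieRep σ ∧ Function.Injective f ∧
        ∀ x ∈ G b, ∀ m, σ x (f m) = f (ρ x m) := by
  induction b with
  | zero =>
    intro M _ _ ρ hρ
    refine ⟨M, _, _, ρ, LinearMap.id, fun x y => ?_, Function.injective_id, fun _ _ _ => rfl⟩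
    exact hρ x (by rw [h.zero]; trivial) y (by rw [h.zero]; trivial)
  | succ b ih =>
    intro M _ _ ρ hρ
    obtain ⟨τ, hτ, hτ0, -⟩ := h.exists_extend_succ b ρ hρ
    obtain ⟨X, _, _, σ, f, hσ, hf, hfσ⟩ := ih (ℕ →₀ M) τ hτ
    refine ⟨X, _, _, σ, f ∘ₗ Finsupp.lsingle 0, hσ, hf.comp (Finsupp.single_injective 0), ?_⟩
    intro x hx m
    simp only [LinearMap.comp_apply, Finsupp.lsingle_apply]
    rw [hfσ x (h.succ_le b hx), hτ0 x hx]

end IsVectorFieldFiltration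

/-! ### The universal enveloping algebra and induced modules -/

section EnvelopingAlgebra

variable {R L : Type*} [CommRing R] [LieRing L] [LieAlgebra R L]

theorem UniversalEnvelopingAlgebra.mem_of_ι_mem
    (A : Subalgebra R (UniversalEnvelopingAlgebra R L))
    (hA : ∀ x : L, UniversalEnvelopingAlgebra.ι R x ∈ A) (u : UniversalEnvelopingAlgebra R L) :
    u ∈ A := by
  obtain ⟨t, rfl⟩ : ∃ t, UniversalEnvelopingAlgebra.mkAlgHom R L t = u :=
    RingCon.mk'_surjective _ u
  induction t using TensorAlgebra.induction with
  | algebraMap r => rw [AlgHom.commutes]; exact A.algebraMap_mem r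
  | ι x => exact hA x
  | mul a b ha hb => rw [map_mul]; exact A.mul_mem ha hb
  | add a b ha hb => rw [map_add]; exact A.add_mem ha hb

theorem IsLieRep.exists_algHom {K L X : Type*} [Field K] [LieRing L] [LieAlgebra K L]
    [AddCommGroup X] [Module K X] {ρ : L →ₗ[K] Module.End K X} (hρ : IsLieRep ρ) :
    ∃ Φ : UniversalEnvelopingAlgebra K L →ₐ[K] Module.End K X,
      ∀ x, Φ (UniversalEnvelopingAlgebra.ι K x) = ρ x := by
  let _ : LieRing (Module.End K X) := LieRing.ofAssociativeRing
  let _ : LieAlgebra K (Module.End K X) := LieAlgebra.ofAssociativeAlgebra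
  let f : L →ₗ⁅K⁆ Module.End K X :=
    { ρ with
      map_lie' := fun {x y} => by
        rw [LieRing.of_associative_ring_bracket]
        exact LinearMap.ext (hρ x y) }
  exact ⟨UniversalEnvelopingAlgebra.lift K f, fun x =>
    UniversalEnvelopingAlgebra.lift_ι_apply K f x⟩

end EnvelopingAlgebra

namespace InducedModule

section Gen

variable {R L : Type*} [CommRing R] [LieRing L] [LieAlgebra R L]
  (H : LieSubalgebra R L) (χ : LieAlgebra.LieCharacter R H)

/-- The canonical generator `1 ⊗ 1` of an induced module. -/
def gen : InducedModule H χ :=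
  (Submodule.Quotient.mk ((1 : UniversalEnvelopingAlgebra R L) ⊗ₜ[R] (1 : R)) :
    (UniversalEnvelopingAlgebra R L ⊗[R] R) ⧸ inducedRel H χ)

theorem lie_gen (y : H) : ⁅(y : L), gen H χ⁆ = χ y • gen H χ := by
  have h := (Submodule.Quotient.eq (inducedRel H χ)).mpr
    (Submodule.subset_span ⟨1, y, 1, rfl⟩ :
      ((1 : UniversalEnvelopingAlgebra R L) * UniversalEnvelopingAlgebra.ι R (y : L)) ⊗ₜ[R] (1 : R) -
        (1 : UniversalEnvelopingAlgebra R L) ⊗ₜ[R] (χ y * 1) ∈ inducedRel H χ)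
  rw [one_mul, mul_one, ← mul_one (UniversalEnvelopingAlgebra.ι R (y : L)), ← smul_eq_mul,
    ← TensorProduct.smul_tmul', ← mul_one (χ y), ← smul_eq_mul (χ y), TensorProduct.tmul_smul] at h
  exact h

theorem eq_top_of_gen_mem (S : Submodule R (InducedModule H χ)) (h0 : gen H χ ∈ S)
    (hS : ∀ x : L, ∀ m ∈ S, ⁅x, m⁆ ∈ S) : S = ⊤ := by
  let A : Subalgebra R (UniversalEnvelopingAlgebra R L) :=
    { carrier := {u | ∀ m ∈ S, u • m ∈ S}
      mul_mem' := fun {a b} ha hb m hm => by rw [mul_smul]; exact ha _ (hb m hm)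
      add_mem' := fun {a b} ha hb m hm => by rw [add_smul]; exact S.add_mem (ha m hm) (hb m hm)
      algebraMap_mem' := fun r m hm => by rw [algebraMap_smul]; exact S.smul_mem r hm }
  have hA := UniversalEnvelopingAlgebra.mem_of_ι_mem A hS
  rw [eq_top_iff]
  rintro m -
  obtain ⟨t, rfl⟩ := Submodule.Quotient.mk_surjective (inducedRel H χ) m
  induction t using TensorProduct.induction_on with
  | zero => exact S.zero_mem
  | add a b ha hb => exact S.add_mem ha hb
  | tmul u c =>
    have e : u ⊗ₜ[R] c = c • u • ((1 : UniversalEnvelopingAlgebra R L) ⊗ₜ[R] (1 : R)) := by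
      rw [TensorProduct.smul_tmul', smul_eq_mul, mul_one, ← TensorProduct.tmul_smul, smul_eq_mul,
        mul_one]
    rw [e]
    exact S.smul_mem c (hA u _ h0)

end Gen

section Lift

variable {K L X : Type*} [Field K] [LieRing L] [LieAlgebra K L] [AddCommGroup X] [Module K X]
  {H : LieSubalgebra K L} {χ : LieAlgebra.LieCharacter K H}

theorem exists_lift {ρ : L →ₗ[K] Module.End K X} (hρ : IsLieRep ρ) {x₀ : X}
    (hx₀ : ∀ y : H, ρ y x₀ = χ y • x₀) :
    ∃ f : InducedModule H χ →ₗ[K] X, (∀ x m, f ⁅x, m⁆ = ρ x (f m)) ∧ f (gen H χ) = x₀ := by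
  obtain ⟨Φ, hΦ⟩ := hρ.exists_algHom
  let g : UniversalEnvelopingAlgebra K L ⊗[K] K →ₗ[K] X :=
    (LinearMap.applyₗ x₀ ∘ₗ Φ.toLinearMap) ∘ₗ (TensorProduct.rid K _).toLinearMap
  have hg : ∀ u c, g (u ⊗ₜ c) = c • Φ u x₀ := fun u c => by simp [g]
  have hgs : ∀ u t, g (u • t) = Φ u (g t) := by
    intro u t
    induction t using TensorProduct.induction_on with
    | zero => simp
    | add a b ha hb => rw [smul_add, map_add, ha, hb, map_add, map_add]
    | tmul v c => rw [TensorProduct.smul_tmul', hg, hg, smul_eq_mul, map_mul, map_smul]; rfl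
  have hker : (inducedRel H χ).restrictScalars K ≤ LinearMap.ker g := by
    intro t ht
    rw [Submodule.restrictScalars_mem] at ht
    refine Submodule.span_induction (p := fun t _ => g t = 0) ?_ (map_zero g)
      (fun a b _ _ ha hb => by rw [map_add, ha, hb, add_zero])
      (fun u a _ ha => by rw [hgs, ha, map_zero]) ht
    rintro _ ⟨u, y, c, rfl⟩
    rw [map_sub, hg, hg, map_mul, hΦ, Module.End.mul_apply, hx₀, map_smul, smul_smul, mul_comm c,
      sub_self]
  let f : InducedModule H χ →ₗ[K] X := (((inducedRel H χ).restrictScalars K).liftQ g hker) ∘ₗ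
    (Submodule.Quotient.restrictScalarsEquiv K (inducedRel H χ)).symm.toLinearMap
  have hf : ∀ t, f (Submodule.Quotient.mk t :
      (UniversalEnvelopingAlgebra K L ⊗[K] K) ⧸ inducedRel H χ) = g t := fun t => rfl
  refine ⟨f, fun x m => ?_, ?_⟩
  · obtain ⟨t, rfl⟩ := Submodule.Quotient.mk_surjective (inducedRel H χ) m
    rw [hf, ← hΦ, ← hgs]
    rfl
  · rw [gen, hf, hg, one_smul, map_one]
    rfl

end Lift

end InducedModule

/-! ### The filtration of the Virasoro algebra at a point -/

theorem eulerD_T (n : ℤ) :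
    eulerD (LaurentPolynomial.T n) = LaurentPolynomial.C (n : ℂ) * LaurentPolynomial.T n := by
  simpa using eulerD_C_mul_T 1 n

theorem eulerD_C (c : ℂ) : eulerD (LaurentPolynomial.C c) = 0 := by
  simpa using eulerD_C_mul_T c 0

theorem eulerD_toLaurent (p : Polynomial ℂ) :
    eulerD (Polynomial.toLaurent p) = Polynomial.toLaurent (Polynomial.X * p.derivative) := by
  induction p using Polynomial.induction_on' with
  | add p q hp hq => simp only [map_add, mul_add, hp, hq]
  | monomial n c =>
    rcases n with _ | n
    · simp [eulerD_C]
    · rw [Polynomial.derivative_monomial, Polynomial.X_mul_monomial,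
        ← Polynomial.C_mul_X_pow_eq_monomial, ← Polynomial.C_mul_X_pow_eq_monomial,
        Polynomial.toLaurent_C_mul_X_pow, Polynomial.toLaurent_C_mul_X_pow, eulerD_C_mul_T,
        mul_comm c]
      simp

theorem constCoeff_toLaurent (p : Polynomial ℂ) :
    constCoeff (Polynomial.toLaurent p) = p.coeff 0 := by
  induction p using Polynomial.induction_on' with
  | add p q hp hq => simp only [map_add, Polynomial.coeff_add, hp, hq]
  | monomial n c =>
    rw [← Polynomial.C_mul_X_pow_eq_monomial, Polynomial.toLaurent_C_mul_X_pow,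
      constCoeff_C_mul_T]
    simp [Polynomial.coeff_X_pow, eq_comm]

theorem T_neg_mul_T (n : ℤ) :
    (LaurentPolynomial.T (-n) : ℂ[T;T⁻¹]) * LaurentPolynomial.T n = 1 := by
  rw [← LaurentPolynomial.T_add, neg_add_cancel, LaurentPolynomial.T_zero]

namespace Virasoro

theorem linPow_eq_toLaurent (a : ℂ) (n : ℕ) :
    linPow a n = Polynomial.toLaurent ((Polynomial.X - Polynomial.C a) ^ n) := by
  simp [linPow]

theorem linPow_ne_zero (a : ℂ) (n : ℕ) : linPow a n ≠ 0 := by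
  rw [linPow_eq_toLaurent, Polynomial.toLaurent_ne_zero]
  exact pow_ne_zero _ (Polynomial.X_sub_C_ne_zero a)

theorem linPow_add (a : ℂ) (m n : ℕ) : linPow a (m + n) = linPow a m * linPow a n := pow_add _ _ _

theorem linPow_one (a : ℂ) : linPow a 1 = LaurentPolynomial.T 1 - LaurentPolynomial.C a := pow_one _

theorem linPow_dvd_linPow (a : ℂ) {m n : ℕ} (h : m ≤ n) : linPow a m ∣ linPow a n :=
  pow_dvd_pow _ h

theorem eulerD_linPow_succ (a : ℂ) (n : ℕ) :
    eulerD (linPow a (n + 1)) =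
      LaurentPolynomial.C ((n : ℂ) + 1) * LaurentPolynomial.T 1 * linPow a n := by
  induction n with
  | zero => simp [linPow, eulerD_T, eulerD_C]
  | succ n ih =>
    rw [linPow_add a (n + 1) 1, eulerD_mul, ih, linPow_add a n 1, linPow_one, map_sub, eulerD_T,
      eulerD_C]
    push_cast
    simp only [map_add, map_one]
    ring

theorem linPow_dvd_eulerD {a : ℂ} {n : ℕ} {f : ℂ[T;T⁻¹]} (h : linPow a n ∣ f) :
    linPow a (n - 1) ∣ eulerD f := by
  obtain ⟨g, rfl⟩ := h
  rcases n with _ | n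
  · simp [linPow]
  · rw [eulerD_mul, eulerD_linPow_succ, Nat.add_sub_cancel]
    exact dvd_add ((Dvd.intro_left _ rfl).mul_right g)
      ((linPow_dvd_linPow a n.le_succ).mul_right _)

theorem linPow_one_dvd_T_sub {a : ℂ} (ha : a ≠ 0) (n : ℤ) :
    linPow a 1 ∣ LaurentPolynomial.T n - LaurentPolynomial.C (a ^ n) := by
  have hnat : ∀ n : ℕ, linPow a 1 ∣ LaurentPolynomial.T (n : ℤ) - LaurentPolynomial.C (a ^ n) := by
    intro n
    have := sub_dvd_pow_sub_pow (LaurentPolynomial.T 1 : ℂ[T;T⁻¹]) (LaurentPolynomial.C a) n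
    rwa [LaurentPolynomial.T_pow, mul_one, ← map_pow, ← linPow_one] at this
  obtain ⟨n, rfl | rfl⟩ := n.eq_nat_or_neg
  · simpa using hnat n
  · have e : LaurentPolynomial.T (-(n : ℤ)) - LaurentPolynomial.C (a ^ (-(n : ℤ))) =
        -(LaurentPolynomial.T (-(n : ℤ)) * LaurentPolynomial.C (a ^ (-(n : ℤ)))) *
          (LaurentPolynomial.T (n : ℤ) - LaurentPolynomial.C (a ^ n)) := by
      have h1 := T_neg_mul_T n
      have h2 : LaurentPolynomial.C (a ^ (-(n : ℤ))) * LaurentPolynomial.C (a ^ n) =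
          (1 : ℂ[T;T⁻¹]) := by
        rw [← map_mul, zpow_neg, zpow_natCast, inv_mul_cancel₀ (pow_ne_zero n ha), map_one]
      linear_combination LaurentPolynomial.C (a ^ (-(n : ℤ))) * h1 -
        LaurentPolynomial.T (-(n : ℤ)) * h2
    rw [e]
    exact (hnat n).mul_left _

theorem exists_linPow_one_dvd_sub {a : ℂ} (ha : a ≠ 0) (f : ℂ[T;T⁻¹]) :
    ∃ c : ℂ, linPow a 1 ∣ f - LaurentPolynomial.C c := by
  induction f using LaurentPolynomial.induction_on' with
  | add p q hp hq =>
    obtain ⟨c, hc⟩ := hp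
    obtain ⟨d, hd⟩ := hq
    refine ⟨c + d, ?_⟩
    rw [map_add, add_sub_add_comm]
    exact dvd_add hc hd
  | C_mul_T n c =>
    refine ⟨c * a ^ n, ?_⟩
    rw [map_mul, ← mul_sub]
    exact (linPow_one_dvd_T_sub ha n).mul_left _

theorem not_linPow_one_dvd_T {a : ℂ} (ha : a ≠ 0) (n : ℤ) :
    ¬ linPow a 1 ∣ LaurentPolynomial.T n := by
  rintro ⟨g, hg⟩
  have := congrArg (LaurentPolynomial.eval₂ (RingHom.id ℂ) (Units.mk0 a ha)) hg
  rw [map_mul, linPow_one, map_sub, LaurentPolynomial.eval₂_T, LaurentPolynomial.eval₂_T,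
    LaurentPolynomial.eval₂_C] at this
  exact zpow_ne_zero n ha (by simpa using this)

/-- The subspace of all `x` such that `θ(x)` vanishes to order `b` at `a`. -/
noncomputable def pointFiltration (a : ℂ) (b : ℕ) : Submodule ℂ Virasoro :=
  (polySubalgebra (linPow a b)).toSubmodule

/-- The element `t⁻¹ (t - a) ^ b`, that is, the vector field `(t - a) ^ b d/dt`. -/
noncomputable def pointField (a : ℂ) (b : ℕ) : Virasoro := ofLaurent (LaurentPolynomial.T (-1) * linPow a b)

theorem mem_pointFiltration {a : ℂ} {b : ℕ} {x : Virasoro} :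
    x ∈ pointFiltration a b ↔ linPow a b ∣ theta x :=
  Ideal.mem_span_singleton

theorem isVectorFieldFiltration {a : ℂ} (ha : a ≠ 0) :
    IsVectorFieldFiltration (pointFiltration a) (pointField a) where
  zero := eq_top_iff.mpr fun x _ => mem_pointFiltration.mpr (by simp [linPow])
  succ_le b x hx := by
    rw [mem_pointFiltration] at hx ⊢
    exact (linPow_dvd_linPow a b.le_succ).trans hx
  mem b := mem_pointFiltration.mpr (Dvd.intro_left _ rfl)
  notMem b := by
    rw [mem_pointFiltration, pointField, theta_ofLaurent, linPow_add, mul_comm,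
      mul_dvd_mul_iff_right (linPow_ne_zero a b)]
    exact not_linPow_one_dvd_T ha _
  split b x hx := by
    obtain ⟨g, hg⟩ := mem_pointFiltration.mp hx
    obtain ⟨c, hc⟩ := exists_linPow_one_dvd_sub ha g
    have h1 := linPow_one_dvd_T_sub ha (-1)
    -- The factor `a` compensates the value `a⁻¹` of the prefactor `t⁻¹` of `pointField` at `a`.
    refine ⟨c * a, mem_pointFiltration.mpr ?_⟩
    have e : theta (x - (c * a) • pointField a b) = linPow a b *
        ((g - LaurentPolynomial.C c) - LaurentPolynomial.C (c * a) *
          (LaurentPolynomial.T (-1) - LaurentPolynomial.C (a ^ (-1 : ℤ)))) := by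
      have h2 : LaurentPolynomial.C (c * a) * LaurentPolynomial.C (a ^ (-1 : ℤ)) =
          (LaurentPolynomial.C c : ℂ[T;T⁻¹]) := by
        rw [← map_mul, zpow_neg_one, mul_assoc, mul_inv_cancel₀ ha, mul_one]
      rw [map_sub, map_smul, hg, pointField, theta_ofLaurent, LaurentPolynomial.smul_eq_C_mul]
      linear_combination - linPow a b * h2
    rw [e, linPow_add]
    exact mul_dvd_mul_left _ (dvd_sub hc (h1.mul_left _))
  lie_mem m n x hx y hy := by
    rw [mem_pointFiltration] at *
    rw [theta_lie, wittBracket_apply]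
    refine dvd_sub ?_ ?_
    · refine (linPow_dvd_linPow a (by omega : m + n - 1 ≤ m + (n - 1))).trans ?_
      rw [linPow_add]
      exact mul_dvd_mul hx (linPow_dvd_eulerD hy)
    · refine (linPow_dvd_linPow a (by omega : m + n - 1 ≤ n + (m - 1))).trans ?_
      rw [linPow_add]
      exact mul_dvd_mul hy (linPow_dvd_eulerD hx)
  lie_w m n M hmn := by
    rw [mem_pointFiltration]
    convert dvd_zero (linPow a M)
    have h1 : (LaurentPolynomial.T (-1) : ℂ[T;T⁻¹]) * LaurentPolynomial.T 1 = 1 := T_neg_mul_T 1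
    rw [map_sub, map_smul, theta_lie, wittBracket_apply, LaurentPolynomial.smul_eq_C_mul]
    simp only [pointField, theta_ofLaurent, eulerD_mul, eulerD_T]
    rcases m with _ | m <;> rcases n with _ | n
    · omega
    · have h0 : eulerD (linPow a 0) = 0 := by simpa [linPow] using eulerD_C 1
      rw [h0, eulerD_linPow_succ, show 0 + (n + 1) - 1 = n by omega,
        show linPow a 0 = 1 from pow_zero _]
      push_cast
      simp only [map_sub, map_add, map_one, map_zero]
      linear_combination (LaurentPolynomial.C (n : ℂ) + 1) * LaurentPolynomial.T (-1) *
        linPow a n * h1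
    · have h0 : eulerD (linPow a 0) = 0 := by simpa [linPow] using eulerD_C 1
      rw [h0, eulerD_linPow_succ, show m + 1 + 0 - 1 = m by omega,
        show linPow a 0 = 1 from pow_zero _]
      push_cast
      simp only [map_sub, map_add, map_one, map_zero]
      linear_combination -(LaurentPolynomial.C (m : ℂ) + 1) * LaurentPolynomial.T (-1) *
        linPow a m * h1
    · rw [eulerD_linPow_succ, eulerD_linPow_succ, show m + 1 + (n + 1) - 1 = m + n + 1 by omega,
        linPow_add a (m + n) 1, linPow_add a m n, linPow_add a m 1, linPow_add a n 1]
      push_cast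
      simp only [map_sub, map_add, map_one]
      linear_combination (LaurentPolynomial.C (n : ℂ) - LaurentPolynomial.C (m : ℂ)) *
        LaurentPolynomial.T (-1) * linPow a m * linPow a n * linPow a 1 * h1

/-! ### Characters -/

theorem eq_ofLaurent_add (x : Virasoro) : x = ofLaurent (theta x) + central x • z := by
  ext1 <;> simp

theorem lie_ofLaurent (f g : ℂ[T;T⁻¹]) :
    ⁅ofLaurent f, ofLaurent g⁆ = ofLaurent (wittBracket f g) + virCocycle f g • z := rfl

theorem ofLaurent_T_mul_linPow_mem (a : ℂ) (n : ℕ) (j : ℤ) :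
    ofLaurent (LaurentPolynomial.T j * linPow a n) ∈ pointFiltration a n :=
  mem_pointFiltration.mpr (Dvd.intro_left _ rfl)

theorem wittBracket_T_mul (f : ℂ[T;T⁻¹]) (j k : ℤ) :
    wittBracket (LaurentPolynomial.T j * f) (LaurentPolynomial.T k * f) =
      ((k : ℂ) - j) • (LaurentPolynomial.T (j + k) * (f * f)) := by
  rw [wittBracket_apply, eulerD_mul, eulerD_mul, eulerD_T, eulerD_T, LaurentPolynomial.T_add,
    LaurentPolynomial.smul_eq_C_mul, map_sub]
  ring

theorem virCocycle_T_mul_toLaurent (p : Polynomial ℂ) (j : ℤ) :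
    virCocycle (LaurentPolynomial.T j * Polynomial.toLaurent p)
      (LaurentPolynomial.T (-j) * Polynomial.toLaurent p) =
      ((j : ℂ) ^ 3 - j) / 12 * p.coeff 0 ^ 2 := by
  -- `E` is the Euler derivation conjugated by `t ^ j`. The powers `t ^ j` and `t ^ (-j)` then
  -- cancel, and the constant coefficient of a product of polynomials involves only their values at
  -- zero.
  let E : Polynomial ℂ → Polynomial ℂ := fun p =>
    Polynomial.X * p.derivative + Polynomial.C (j : ℂ) * p
  have hE0 : ∀ p, (E p).coeff 0 = j * p.coeff 0 := fun p => by simp [E]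
  have hE : ∀ p, eulerD (LaurentPolynomial.T j * Polynomial.toLaurent p) =
      LaurentPolynomial.T j * Polynomial.toLaurent (E p) := fun p => by
    rw [eulerD_mul, eulerD_T, eulerD_toLaurent, map_add, map_mul _ (Polynomial.C _),
      Polynomial.toLaurent_C]
    ring
  have h1 := T_neg_mul_T j
  have e : (LaurentPolynomial.T j * Polynomial.toLaurent (E (E (E p))) -
      LaurentPolynomial.T j * Polynomial.toLaurent (E p)) *
      (LaurentPolynomial.T (-j) * Polynomial.toLaurent p) =
      Polynomial.toLaurent ((E (E (E p)) - E p) * p) := by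
    rw [map_mul, map_sub]
    linear_combination (Polynomial.toLaurent (E (E (E p))) - Polynomial.toLaurent (E p)) *
      Polynomial.toLaurent p * h1
  rw [virCocycle, LinearMap.mk₂_apply, hE, hE, hE, e, constCoeff_toLaurent,
    Polynomial.mul_coeff_zero, Polynomial.coeff_sub, hE0, hE0, hE0]
  ring

section Character

variable {a : ℂ} {n : ℕ} {ν : Virasoro →ₗ[ℂ] ℂ}

/-- With `f = (t - a) ^ n`, the bracket of `t ^ j f` and `t ^ (-j) f` is `-2 j f ^ 2` plus a
multiple of `z` cubic in `j`. Comparing `j = 1` and `j = 2` isolates `z`, since `f` does not vanish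
at zero. -/
theorem character_z (ha : a ≠ 0)
    (hν : ∀ x ∈ pointFiltration a n, ∀ y ∈ pointFiltration a n, ν ⁅x, y⁆ = 0) : ν z = 0 := by
  have key : ∀ j : ℤ, -(2 * (j : ℂ)) * ν (ofLaurent (linPow a n * linPow a n)) +
      ((j : ℂ) ^ 3 - j) / 12 * (((-a) ^ n) ^ 2) * ν z = 0 := by
    intro j
    have h := hν _ (ofLaurent_T_mul_linPow_mem a n j) _ (ofLaurent_T_mul_linPow_mem a n (-j))
    rw [lie_ofLaurent, wittBracket_T_mul, add_neg_cancel, LaurentPolynomial.T_zero, one_mul,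
      map_add, map_smul, map_smul, map_smul] at h
    have h' := virCocycle_T_mul_toLaurent ((Polynomial.X - Polynomial.C a) ^ n) j
    rw [← linPow_eq_toLaurent, Polynomial.coeff_zero_eq_eval_zero] at h'
    rw [h'] at h
    simp only [smul_eq_mul, Polynomial.eval_pow, Polynomial.eval_sub, Polynomial.eval_X,
      Polynomial.eval_C, zero_sub, Int.cast_neg] at h
    rw [← h]
    ring
  have h1 := key 1
  have h2 := key 2
  push_cast at h1 h2
  have h3 : ((-a) ^ n) ^ 2 * ν z = 0 := by linear_combination 2 * h2 - 4 * h1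
  exact (mul_eq_zero.mp h3).resolve_left (pow_ne_zero _ (pow_ne_zero _ (neg_ne_zero.mpr ha)))

theorem character_eq_zero_iff (hz : ν z = 0) {b : ℕ} :
    (∀ x ∈ pointFiltration a b, ν x = 0) ↔
      ∀ j : ℤ, ν (ofLaurent (LaurentPolynomial.T j * linPow a b)) = 0 := by
  refine ⟨fun h j => h _ (ofLaurent_T_mul_linPow_mem a b j), fun h x hx => ?_⟩
  have key : ∀ g, ν (ofLaurent (linPow a b * g)) = 0 := by
    intro g
    induction g using LaurentPolynomial.induction_on' with
    | add p q hp hq => rw [mul_add, map_add, map_add, hp, hq, add_zero]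
    | C_mul_T j c =>
      rw [mul_left_comm, mul_comm (linPow a b), ← LaurentPolynomial.smul_eq_C_mul, map_smul,
        map_smul, h, smul_zero]
  obtain ⟨g, hg⟩ := mem_pointFiltration.mp hx
  rw [eq_ofLaurent_add x, map_add, map_smul, hz, smul_zero, add_zero, hg, key]

theorem character_two_mul (ha : a ≠ 0)
    (hν : ∀ x ∈ pointFiltration a n, ∀ y ∈ pointFiltration a n, ν ⁅x, y⁆ = 0) :
    ∀ x ∈ pointFiltration a (2 * n), ν x = 0 := by
  have hz := character_z ha hν
  refine (character_eq_zero_iff hz).mpr fun i => ?_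
  have key : ∀ j k : ℤ, k ≠ j →
      ν (ofLaurent (LaurentPolynomial.T (j + k) * linPow a (2 * n))) = 0 := by
    intro j k hjk
    have h := hν _ (ofLaurent_T_mul_linPow_mem a n j) _ (ofLaurent_T_mul_linPow_mem a n k)
    rw [lie_ofLaurent, wittBracket_T_mul, ← linPow_add, ← two_mul, map_add, map_smul, map_smul,
      map_smul, hz, smul_zero, add_zero] at h
    exact (smul_eq_zero.mp h).resolve_left (sub_ne_zero.mpr (Int.cast_injective.ne hjk))
  -- Every integer is a sum of two distinct integers: `i = 0 + i`, except for `0 = -1 + 1`.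
  rcases eq_or_ne i 0 with rfl | hi
  · have := key (-1) 1 (by norm_num)
    rwa [neg_add_cancel] at this
  · have := key 0 i hi
    rwa [zero_add] at this

end Character

end Virasoro

/-! ### Finite differences -/

theorem fwdDiff_iter_eval_intCast (p : Polynomial ℂ) (l : ℕ) (j : ℤ) :
    (fwdDiff 1)^[l] (fun i : ℤ => p.eval (i : ℂ)) j =
      (fwdDiff 1)^[l] (fun x : ℂ => p.eval x) (j : ℂ) := by
  induction l generalizing j with
  | zero => rfl
  | succ l ih =>
    rw [Function.iterate_succ_apply', Function.iterate_succ_apply', fwdDiff, fwdDiff, ih, ih,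
      Int.cast_add, Int.cast_one]

theorem fwdDiff_iter_eq_zero_of_le {φ : ℤ → ℂ} {l d : ℕ} (hld : l ≤ d)
    (h : (fwdDiff 1)^[l] φ = 0) : (fwdDiff 1)^[d] φ = 0 := by
  obtain ⟨e, rfl⟩ := Nat.exists_eq_add_of_le' hld
  rw [Function.iterate_add_apply, h]
  clear hld
  induction e with
  | zero => rfl
  | succ e ih =>
    rw [Function.iterate_succ_apply', ih]
    funext j
    simp [fwdDiff]

theorem fwdDiff_iter_eval_eq_zero_iff (p : Polynomial ℂ) (l : ℕ) :
    (fwdDiff 1)^[l] (fun i : ℤ => p.eval (i : ℂ)) = 0 ↔ p = 0 ∨ p.natDegree < l := by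
  constructor
  · intro h
    by_contra! hc
    have h0 := congrFun (fwdDiff_iter_eq_zero_of_le hc.2 h) 0
    rw [fwdDiff_iter_eval_intCast, Polynomial.fwdDiff_iter_degree_eq_factorial] at h0
    simp [hc.1, Nat.factorial_ne_zero] at h0
  · rintro (rfl | h)
    · simp only [Polynomial.eval_zero]
      exact fwdDiff_iter_eq_zero_of_le (Nat.zero_le l) rfl
    · funext j
      rw [fwdDiff_iter_eval_intCast, Polynomial.fwdDiff_iter_eq_zero_of_degree_lt h]
      rfl

/-- Newton interpolation: a function on `ℤ` with a vanishing iterated difference is given by a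
polynomial. -/
theorem exists_polynomial_of_fwdDiff_iter_eq_zero {φ : ℤ → ℂ} {l : ℕ}
    (h : (fwdDiff 1)^[l] φ = 0) : ∃ p : Polynomial ℂ, ∀ j : ℤ, φ j = p.eval (j : ℂ) := by
  have choosePoly : ∀ k : ℕ, ∃ q : Polynomial ℂ, ∀ m : ℕ, q.eval (m : ℂ) = m.choose k := fun k =>
    ⟨Polynomial.C ((k.factorial : ℂ)⁻¹) * descPochhammer ℂ k, fun m => by
      rw [Polynomial.eval_mul, Polynomial.eval_C, descPochhammer_eval_eq_descFactorial,
        Nat.descFactorial_eq_factorial_mul_choose, Nat.cast_mul,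
        inv_mul_cancel_left₀ (Nat.cast_ne_zero.mpr k.factorial_ne_zero)]⟩
  choose q hq using choosePoly
  -- Newton's formula reaches only the integers to the right of the base point `y`. Negative
  -- arguments are reached by moving `y` to `-N` and comparing the two polynomials at infinitely
  -- many points.
  have hnat : ∀ y : ℤ, ∃ p : Polynomial ℂ, ∀ m : ℕ, φ (y + m) = p.eval (m : ℂ) := by
    intro y
    refine ⟨∑ k ∈ Finset.range l, Polynomial.C ((fwdDiff 1)^[k] φ y) * q k, fun m => ?_⟩
    have hs := shift_eq_sum_fwdDiff_iter (1 : ℤ) φ m y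
    rw [nsmul_one] at hs
    rw [hs, Polynomial.eval_finsetSum]
    have e : ∀ k, m.choose k • (fwdDiff 1)^[k] φ y =
        (Polynomial.C ((fwdDiff 1)^[k] φ y) * q k).eval (m : ℂ) := fun k => by
      rw [Polynomial.eval_mul, Polynomial.eval_C, hq, nsmul_eq_mul, mul_comm]
    simp only [e]
    rcases le_total l (m + 1) with hl | hl
    · refine (Finset.sum_subset (Finset.range_subset_range.mpr hl) fun k _ hk => ?_).symm
      rw [fwdDiff_iter_eq_zero_of_le (by simpa using hk) h]
      simp
    · refine Finset.sum_subset (Finset.range_subset_range.mpr hl) fun k _ hk => ?_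
      rw [Polynomial.eval_mul, hq, Nat.choose_eq_zero_of_lt (by simpa using hk)]
      simp
  obtain ⟨p, hp⟩ := hnat 0
  refine ⟨p, fun j => ?_⟩
  obtain ⟨N, hN⟩ : ∃ N : ℕ, 0 ≤ j + N := ⟨j.natAbs, by omega⟩
  obtain ⟨r, hr⟩ := hnat (-N)
  have hrp : r = p.comp (Polynomial.X - Polynomial.C (N : ℂ)) := by
    refine Polynomial.eq_of_infinite_eval_eq _ _ ?_
    refine Set.Infinite.mono ?_ (Set.infinite_range_of_injective
      (f := fun m : ℕ => ((N + m : ℕ) : ℂ)) fun x y hxy => by simpa using hxy)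
    rintro _ ⟨m, rfl⟩
    change r.eval ((N + m : ℕ) : ℂ) = Polynomial.eval ((N + m : ℕ) : ℂ) _
    rw [← hr, Polynomial.eval_comp, Polynomial.eval_sub, Polynomial.eval_X, Polynomial.eval_C,
      Nat.cast_add (R := ℂ), add_sub_cancel_left, ← hp, Nat.cast_add, neg_add_cancel_left, zero_add]
  obtain ⟨m, hm⟩ := Int.eq_ofNat_of_zero_le hN
  obtain rfl : j = -N + m := by omega
  rw [hr, hrp, Polynomial.eval_comp]
  simp [sub_eq_neg_add]

/-! ### Degree of a character and its order of vanishing -/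

namespace Virasoro

section Degree

variable {a : ℂ} {n : ℕ} {ν : Virasoro →ₗ[ℂ] ℂ}

/-- Multiplying by `t - a` sends `φ j * a ^ j` to `φ (j + 1) * a ^ (j + 1) - a * φ j * a ^ j`, a
forward difference times `a ^ (j + 1)`. -/
theorem character_T_mul_linPow (ha : a ≠ 0) {φ : ℤ → ℂ}
    (hφ : ∀ j, ν (ofLaurent (LaurentPolynomial.T j * linPow a n)) = φ j * a ^ j) (l : ℕ) (j : ℤ) :
    ν (ofLaurent (LaurentPolynomial.T j * linPow a (n + l))) =
      (fwdDiff 1)^[l] φ j * a ^ (j + l) := by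
  induction l generalizing j with
  | zero => simpa using hφ j
  | succ l ih =>
    have e : LaurentPolynomial.T j * linPow a (n + (l + 1)) =
        LaurentPolynomial.T (j + 1) * linPow a (n + l) -
          a • (LaurentPolynomial.T j * linPow a (n + l)) := by
      rw [← add_assoc, linPow_add a (n + l) 1, linPow_one, LaurentPolynomial.T_add,
        LaurentPolynomial.smul_eq_C_mul]
      ring
    rw [e, map_sub, map_sub, map_smul, map_smul, ih, ih, Function.iterate_succ_apply', fwdDiff,
      smul_eq_mul, show j + 1 + (l : ℤ) = j + l + 1 by ring,
      show j + ((l + 1 : ℕ) : ℤ) = j + l + 1 by push_cast; ring, zpow_add_one₀ ha]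
    ring

theorem character_eq_zero_iff_fwdDiff (ha : a ≠ 0) (hz : ν z = 0) {φ : ℤ → ℂ}
    (hφ : ∀ j, ν (ofLaurent (LaurentPolynomial.T j * linPow a n)) = φ j * a ^ j) (l : ℕ) :
    (∀ x ∈ pointFiltration a (n + l), ν x = 0) ↔ (fwdDiff 1)^[l] φ = 0 := by
  rw [character_eq_zero_iff hz, funext_iff]
  refine forall_congr' fun j => ?_
  rw [character_T_mul_linPow ha hφ, mul_eq_zero, or_iff_left (zpow_ne_zero _ ha), Pi.zero_apply]

variable {μ : LieAlgebra.LieCharacter ℂ (polySubalgebra (linPow a n))}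

/-- A linear form on the Virasoro algebra extends the character `μ` of a subalgebra. -/
def Extends (ν : Virasoro →ₗ[ℂ] ℂ) (μ : LieAlgebra.LieCharacter ℂ (polySubalgebra (linPow a n))) :
    Prop :=
  ∀ x : polySubalgebra (linPow a n), ν x = μ x

theorem exists_extends (μ : LieAlgebra.LieCharacter ℂ (polySubalgebra (linPow a n))) :
    ∃ ν : Virasoro →ₗ[ℂ] ℂ, Extends ν μ := by
  obtain ⟨ν, hν⟩ := LinearMap.exists_extend
    (p := (polySubalgebra (linPow a n)).toSubmodule) (μ : polySubalgebra (linPow a n) →ₗ[ℂ] ℂ)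
  exact ⟨ν, fun x => LinearMap.congr_fun hν x⟩

theorem Extends.lie_eq_zero (h : Extends ν μ) :
    ∀ x ∈ pointFiltration a n, ∀ y ∈ pointFiltration a n, ν ⁅x, y⁆ = 0 := by
  intro x hx y hy
  have := h ⁅(⟨x, hx⟩ : polySubalgebra (linPow a n)), (⟨y, hy⟩ : polySubalgebra (linPow a n))⁆
  rwa [LieAlgebra.lieCharacter_apply_lie] at this

theorem Extends.isAssociated_iff (h : Extends ν μ) {p : Polynomial ℂ} :
    IsAssociated μ p ↔
      ∀ j : ℤ, ν (ofLaurent (LaurentPolynomial.T j * linPow a n)) = p.eval (j : ℂ) * a ^ j :=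
  forall_congr' fun j => by rw [← h (polyElt (linPow a n) j)]; rfl

theorem Extends.eq_zero_iff (h : Extends ν μ) : μ = 0 ↔ ∀ x ∈ pointFiltration a n, ν x = 0 := by
  constructor
  · rintro rfl x hx
    exact h ⟨x, hx⟩
  · intro h0
    refine DFunLike.ext _ _ fun x => ?_
    rw [← h x, h0 x x.2]
    rfl

theorem Extends.exists_isAssociated (ha : a ≠ 0) (h : Extends ν μ) :
    ∃ p : Polynomial ℂ, IsAssociated μ p := by
  have hφ : ∀ j : ℤ, ν (ofLaurent (LaurentPolynomial.T j * linPow a n)) =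
      (ν (ofLaurent (LaurentPolynomial.T j * linPow a n)) * a ^ (-j)) * a ^ j := fun j => by
    rw [mul_assoc, ← zpow_add₀ ha, neg_add_cancel, zpow_zero, mul_one]
  have h2 := character_two_mul ha h.lie_eq_zero
  rw [two_mul, character_eq_zero_iff_fwdDiff ha (character_z ha h.lie_eq_zero) hφ] at h2
  obtain ⟨p, hp⟩ := exists_polynomial_of_fwdDiff_iter_eq_zero h2
  exact ⟨p, h.isAssociated_iff.mpr fun j => by rw [hφ j, hp j]⟩

/-- A nonzero character of degree at least `n - 2` has order of vanishing at least `2 n - 1`. -/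
theorem Extends.exists_order (ha : a ≠ 0) (h : Extends ν μ) (hμ : μ ≠ 0) {r : ℤ}
    (hr : HasDegree μ r) (hnr : (n : ℤ) - 2 ≤ r) :
    ∃ m, n + 1 ≤ m ∧ 2 * n ≤ m + 1 ∧ (∀ x ∈ pointFiltration a m, ν x = 0) ∧
      ν (pointField a (m - 1)) ≠ 0 := by
  classical
  have hz := character_z ha h.lie_eq_zero
  have hF := isVectorFieldFiltration ha
  have hex : ∃ m, n ≤ m ∧ ∀ x ∈ pointFiltration a m, ν x = 0 :=
    ⟨2 * n, by omega, character_two_mul ha h.lie_eq_zero⟩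
  obtain ⟨hm1, hm2⟩ := Nat.find_spec hex
  have hmin : ∀ k, n ≤ k → (∀ x ∈ pointFiltration a k, ν x = 0) → Nat.find hex ≤ k :=
    fun k h1 h2 => Nat.find_min' hex ⟨h1, h2⟩
  generalize Nat.find hex = m at hm1 hm2 hmin
  have hnm : n + 1 ≤ m := by
    refine Nat.succ_le_of_lt (lt_of_le_of_ne hm1 ?_)
    rintro rfl
    exact hμ (h.eq_zero_iff.mpr hm2)
  refine ⟨m, hnm, ?_, hm2, fun h0 => ?_⟩
  -- An order of vanishing at most `2 n - 2` would force the difference of order `n - 2` of `p` to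
  -- vanish, that is, degree below `n - 2`. If `p = 0`, so that the degree is `-1`, the bounds on
  -- `n` and `m` already conflict.
  · by_contra! hlt
    obtain ⟨p, hp, rfl⟩ := hr
    have hv : ∀ x ∈ pointFiltration a (n + (n - 2)), ν x = 0 := fun x hx =>
      hm2 x (hF.anti (by omega) hx)
    rw [character_eq_zero_iff_fwdDiff ha hz (h.isAssociated_iff.mp hp),
      fwdDiff_iter_eval_eq_zero_iff] at hv
    split_ifs at hnr with hp0
    · omega
    · have := hv.resolve_left hp0
      omega
  · have := hmin (m - 1) (by omega) fun x hx => by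
      obtain ⟨c, hc⟩ := hF.split _ x hx
      rw [Nat.sub_add_cancel (by omega)] at hc
      have := hm2 _ hc
      rwa [map_sub, map_smul, h0, smul_zero, sub_zero] at this
    omega

/-- A character which is zero or of degree less than `n - 2` extends to a character of the next
larger subalgebra. -/
theorem exists_extends_lie_eq_zero (ha : a ≠ 0) (hn : 1 ≤ n)
    (hμ : ¬(μ ≠ 0 ∧ ∃ r : ℤ, HasDegree μ r ∧ (n : ℤ) - 2 ≤ r)) :
    ∃ ν : Virasoro →ₗ[ℂ] ℂ, Extends ν μ ∧
      ∀ x ∈ pointFiltration a (n - 1), ∀ y ∈ pointFiltration a (n - 1), ν ⁅x, y⁆ = 0 := by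
  obtain ⟨ν, h⟩ := exists_extends μ
  have hF := isVectorFieldFiltration ha
  obtain ⟨p, hp⟩ := h.exists_isAssociated ha
  have hlt : μ ≠ 0 → (if p = 0 then -1 else (p.natDegree : ℤ)) < (n : ℤ) - 2 := fun h0 => by
    by_contra! hle
    exact hμ ⟨h0, _, ⟨p, hp, rfl⟩, hle⟩
  by_cases h0 : μ = 0
  · subst h0
    exact ⟨0, fun x => rfl, fun x _ y _ => rfl⟩
  · specialize hlt h0
    refine ⟨ν, h, fun x hx y hy => ?_⟩
    have hpn : p = 0 ∨ p.natDegree < n - 2 := by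
      split_ifs at hlt with hp0
      · exact Or.inl hp0
      · right; omega
    -- This makes the subtraction in `n - 2` genuine, so that `n + (n - 2) = 2 * (n - 1)`, the order
    -- of vanishing of brackets in `G (n - 1)`.
    have hn2 : 2 ≤ n := by split_ifs at hlt <;> omega
    rw [← fwdDiff_iter_eval_eq_zero_iff, ← character_eq_zero_iff_fwdDiff ha
      (character_z ha h.lie_eq_zero) (h.isAssociated_iff.mp hp)] at hpn
    refine hpn _ ?_
    rw [show n + (n - 2) = 2 * (n - 1) by omega]
    exact hF.lie_mem_two_mul hx hy

end Degree

end Virasoro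

/-! ### The induced module at one point -/

namespace Virasoro

section Induced

variable {a : ℂ} {n : ℕ} {ν : Virasoro →ₗ[ℂ] ℂ}
  {μ : LieAlgebra.LieCharacter ℂ (polySubalgebra (linPow a n))}

/-- The canonical generator of `V_μ`. -/
noncomputable abbrev indGen (μ : LieAlgebra.LieCharacter ℂ (polySubalgebra (linPow a n))) :
    InducedVir μ :=
  InducedModule.gen (polySubalgebra (linPow a n)) μ

theorem Extends.lie_indGen (h : Extends ν μ) {x : Virasoro} (hx : x ∈ pointFiltration a n) :
    ⁅x, indGen μ⁆ = ν x • indGen μ := by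
  rw [h ⟨x, hx⟩]
  exact InducedModule.lie_gen _ μ ⟨x, hx⟩

/-- The one-dimensional representation given by a linear form. -/
noncomputable def scalarRep (ν : Virasoro →ₗ[ℂ] ℂ) : Virasoro →ₗ[ℂ] Module.End ℂ ℂ :=
  ν.smulRight 1

theorem scalarRep_apply (x : Virasoro) (c : ℂ) : scalarRep ν x c = ν x • c := rfl

theorem isLieRepOn_scalarRep {H : Submodule ℂ Virasoro} (hν : ∀ x ∈ H, ∀ y ∈ H, ν ⁅x, y⁆ = 0) :
    IsLieRepOn H (scalarRep ν) := by
  intro x hx y hy u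
  simp only [scalarRep_apply, hν x hx y hy, smul_eq_mul]
  ring

theorem indGen_ne_zero (ha : a ≠ 0) : indGen μ ≠ 0 := by
  obtain ⟨ν, h⟩ := exists_extends μ
  obtain ⟨X, _, _, σ, f, hσ, hf, hfσ⟩ := (isVectorFieldFiltration ha).exists_extend n ℂ
    (scalarRep ν) (isLieRepOn_scalarRep h.lie_eq_zero)
  obtain ⟨F, -, hF⟩ := InducedModule.exists_lift (χ := μ) hσ (x₀ := f 1) fun y => by
    rw [hfσ y y.2, scalarRep_apply, map_smul, h y]
  intro h0
  rw [indGen] at h0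
  rw [h0, map_zero] at hF
  exact one_ne_zero (hf (hF.symm.trans (map_zero f).symm))

/-- The submodule is the kernel of the map to a representation where `G (n - 1)` acts on the image
of the generator through `ν`. It contains `pointField a (n - 1) - ν (pointField a (n - 1))` applied
to the generator. -/
theorem exists_proper_submodule (ha : a ≠ 0) (hn : 1 ≤ n) (h : Extends ν μ)
    (hν : ∀ x ∈ pointFiltration a (n - 1), ∀ y ∈ pointFiltration a (n - 1), ν ⁅x, y⁆ = 0) :
    ∃ K : Submodule ℂ (InducedVir μ), (∀ x : Virasoro, ∀ m ∈ K, ⁅x, m⁆ ∈ K) ∧ K ≠ ⊥ ∧ K ≠ ⊤ := by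
  have hF := isVectorFieldFiltration ha
  have hle : ∀ y : polySubalgebra (linPow a n), (y : Virasoro) ∈ pointFiltration a (n - 1) :=
    fun y => hF.anti (Nat.sub_le n 1) y.2
  obtain ⟨X, _, _, σ, f, hσ, hf, hfσ⟩ := hF.exists_extend (n - 1) ℂ
    (scalarRep ν) (isLieRepOn_scalarRep hν)
  obtain ⟨F, hFσ, hF1⟩ := InducedModule.exists_lift (χ := μ) hσ (x₀ := f 1) fun y => by
    rw [hfσ y (hle y), scalarRep_apply, map_smul, h y]
  -- A second target serves to show that this vector is nonzero: inducing from `G n` to `G (n - 1)`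
  -- first, `pointField a (n - 1)` moves the generator to the independent vector `single 1 1`.
  obtain ⟨τ, hτ, hτ0, hτ1⟩ := hF.exists_extend_succ (n - 1) (scalarRep ν)
    (by rw [Nat.sub_add_cancel hn]; exact isLieRepOn_scalarRep h.lie_eq_zero)
  rw [Nat.sub_add_cancel hn] at hτ0
  obtain ⟨X', _, _, σ', f', hσ', hf', hfσ'⟩ := hF.exists_extend (n - 1) (ℕ →₀ ℂ) τ hτ
  obtain ⟨F', hFσ', hF1'⟩ := InducedModule.exists_lift (χ := μ) hσ'
    (x₀ := f' (Finsupp.single 0 1)) fun y => by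
      rw [hfσ' y (hle y), hτ0 y y.2, scalarRep_apply, h y, ← map_smul, Finsupp.smul_single]
  refine ⟨LinearMap.ker F, fun x m hm => ?_, fun hbot => ?_, fun htop => ?_⟩
  · rw [LinearMap.mem_ker] at hm ⊢
    rw [hFσ, hm, map_zero]
  · have hmem : ⁅pointField a (n - 1), indGen μ⁆ - ν (pointField a (n - 1)) • indGen μ ∈
        LinearMap.ker F := by
      rw [LinearMap.mem_ker, map_sub, map_smul, hFσ, hF1, hfσ _ (hF.mem _), scalarRep_apply,
        map_smul, sub_self]
    rw [hbot, Submodule.mem_bot] at hmem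
    have h0 := congrArg F' hmem
    rw [map_sub, map_smul, hFσ', hF1', hfσ' _ (hF.mem _), hτ1, map_zero, ← map_smul, ← map_sub,
      ← map_zero f'] at h0
    simpa using DFunLike.congr_fun (hf' h0) 1
  · have h0 : F (indGen μ) = 0 := by
      rw [← LinearMap.mem_ker, htop]
      trivial
    rw [hF1, ← map_zero f] at h0
    exact one_ne_zero (hf h0)

theorem exists_pointFiltration_lie_eq_zero (ha : a ≠ 0) (m : InducedVir μ) :
    ∃ M, ∀ x ∈ pointFiltration a M, ⁅x, m⁆ = 0 := by
  obtain ⟨ν, h⟩ := exists_extends μ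
  have hF := isVectorFieldFiltration ha
  let S : Submodule ℂ (InducedVir μ) :=
    { carrier := {m | ∃ M, ∀ x ∈ pointFiltration a M, ⁅x, m⁆ = 0}
      add_mem' := by
        rintro u v ⟨M, hM⟩ ⟨M', hM'⟩
        refine ⟨max M M', fun x hx => ?_⟩
        rw [lie_add, hM x (hF.anti (le_max_left _ _) hx), hM' x (hF.anti (le_max_right _ _) hx),
          add_zero]
      zero_mem' := ⟨0, fun x _ => lie_zero x⟩
      smul_mem' := by
        rintro c u ⟨M, hM⟩
        exact ⟨M, fun x hx => by rw [lie_smul, hM x hx, smul_zero]⟩ }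
  have hS : S = ⊤ := by
    refine InducedModule.eq_top_of_gen_mem _ _ S ⟨2 * n, fun x hx => ?_⟩ ?_
    · have := h.lie_indGen (hF.anti (by omega : n ≤ 2 * n) hx)
      rwa [character_two_mul ha h.lie_eq_zero x hx, zero_smul] at this
    · rintro y m ⟨M, hM⟩
      -- Bracketing with an arbitrary field loses at most one order of vanishing.
      refine ⟨M + 1, fun x hx => ?_⟩
      have hxy : ⁅x, y⁆ ∈ pointFiltration a M :=
        hF.lie_mem_of_le (by omega) hx (by rw [hF.zero]; trivial : y ∈ pointFiltration a 0)
      rw [leibniz_lie, hM _ hxy, hM x (hF.succ_le M hx), lie_zero, add_zero]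
  exact (hS ▸ Submodule.mem_top : m ∈ S)

end Induced

/-! ### Separation of points -/

/-- Chinese remainder theorem at the points `a j` and at zero. The factor `T M` is there so that
only `e_l` with `l ≥ M` occur, which kill a prescribed vector of `V` when `M` is large. -/
theorem exists_separating {ι : Type*} [Fintype ι] [DecidableEq ι] {a : ι → ℂ} (ha : ∀ i, a i ≠ 0)
    (hinj : Function.Injective a) (i : ι) (M : ℕ) (f : ℂ[T;T⁻¹]) :
    ∃ q : Polynomial ℂ,
      linPow (a i) M ∣ f - LaurentPolynomial.T (M : ℤ) * Polynomial.toLaurent q ∧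
      ∀ j ≠ i, linPow (a j) M ∣ LaurentPolynomial.T (M : ℤ) * Polynomial.toLaurent q := by
  obtain ⟨K, F, hF⟩ := LaurentPolynomial.exists_T_pow f
  let R : Polynomial ℂ := ∏ j ∈ Finset.univ.erase i, (Polynomial.X - Polynomial.C (a j)) ^ M
  let Q : Polynomial ℂ := (Polynomial.X - Polynomial.C (a i)) ^ M
  have hcop : IsCoprime (Polynomial.X ^ (K + M) * R) Q := by
    refine IsCoprime.mul_left (IsCoprime.pow ?_) (IsCoprime.prod_left fun j hj => IsCoprime.pow ?_)
    · have := Polynomial.isCoprime_X_sub_C_of_isUnit_sub (R := ℂ) (a := 0) (b := a i)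
        (by simpa using ha i)
      simpa using this
    · exact Polynomial.isCoprime_X_sub_C_of_isUnit_sub
        (sub_ne_zero.mpr (hinj.ne (Finset.ne_of_mem_erase hj))).isUnit
  obtain ⟨u, v, huv⟩ := hcop
  have h1 := T_neg_mul_T (K : ℤ)
  have hTP : (LaurentPolynomial.T (-(K : ℤ)) * Polynomial.toLaurent (Polynomial.X ^ (K + M)) :
      ℂ[T;T⁻¹]) = LaurentPolynomial.T (M : ℤ) := by
    rw [Polynomial.toLaurent_X_pow, ← LaurentPolynomial.T_add]
    congr 1
    push_cast
    ring
  -- With `f = T (-K) F` and the Bézout relation `u X ^ (K + M) R + v Q = 1`, the difference is `T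
  -- (-K) F v Q`; the exponent `K + M` absorbs the denominator of `f`.
  refine ⟨F * u * R, ?_, fun j hj => ?_⟩
  · have e : f - LaurentPolynomial.T (M : ℤ) * Polynomial.toLaurent (F * u * R) =
        Polynomial.toLaurent Q *
          (LaurentPolynomial.T (-(K : ℤ)) * Polynomial.toLaurent (F * v)) := by
      have huv' := congrArg Polynomial.toLaurent huv
      simp only [map_mul, map_add, map_one] at huv' ⊢
      rw [← hTP]
      linear_combination -f * h1 - LaurentPolynomial.T (-(K : ℤ)) * hF -
        LaurentPolynomial.T (-(K : ℤ)) * Polynomial.toLaurent F * huv'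
    rw [e, linPow_eq_toLaurent]
    exact dvd_mul_right _ _
  · rw [linPow_eq_toLaurent]
    refine Dvd.dvd.mul_left (map_dvd _ (Dvd.dvd.mul_left ?_ _)) _
    exact Finset.dvd_prod_of_mem (fun j => (Polynomial.X - Polynomial.C (a j)) ^ M)
      (Finset.mem_erase.mpr ⟨hj, Finset.mem_univ j⟩)

end Virasoro

/-! ### Tensor products of Lie modules -/

section Tensor

set_option linter.unusedSectionVars false

variable {K ι V : Type*} {M : ι → Type*} [Field K]
  [∀ i, AddCommGroup (M i)] [∀ i, Module K (M i)] [AddCommGroup V] [Module K V]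

variable (K) in
/-- The pure tensor `(⨂ m i) ⊗ v`. -/
noncomputable def pureTensor (m : ∀ i, M i) (v : V) : (⨂[K] i, M i) ⊗[K] V :=
  PiTensorProduct.tprod K m ⊗ₜ[K] v

theorem eq_top_of_pureTensor_mem {S : Submodule K ((⨂[K] i, M i) ⊗[K] V)}
    (hS : ∀ m v, pureTensor K m v ∈ S) : S = ⊤ := by
  rw [eq_top_iff]
  rintro u -
  induction u using TensorProduct.induction_on with
  | zero => exact S.zero_mem
  | add x y hx hy => exact S.add_mem hx hy
  | tmul t v =>
    induction t using PiTensorProduct.induction_on with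
    | smul_tprod r m => rw [← TensorProduct.smul_tmul']; exact S.smul_mem r (hS m v)
    | add x y hx hy => rw [TensorProduct.add_tmul]; exact S.add_mem hx hy

theorem pureTensor_update_sub [DecidableEq ι] (m : ∀ i, M i) (i : ι) (x y : M i) (v : V) :
    pureTensor K (Function.update m i (x - y)) v =
      pureTensor K (Function.update m i x) v - pureTensor K (Function.update m i y) v := by
  rw [pureTensor, MultilinearMap.map_update_sub, TensorProduct.sub_tmul]
  rfl

theorem exists_dual_pureTensor [Fintype ι] (f : ∀ i, M i →ₗ[K] K) (g : V →ₗ[K] K) :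
    ∃ F : (⨂[K] i, M i) ⊗[K] V →ₗ[K] K, ∀ m v, F (pureTensor K m v) = (∏ i, f i (m i)) * g v := by
  refine ⟨LinearMap.mul' K K ∘ₗ TensorProduct.map (PiTensorProduct.lift
    ((MultilinearMap.mkPiAlgebra K ι K).compLinearMap f)) g, fun m v => ?_⟩
  simp [pureTensor]

theorem exists_dual_ne_zero {v : V} (hv : v ≠ 0) : ∃ g : V →ₗ[K] K, g v ≠ 0 := by
  obtain ⟨g, hg, -⟩ := Submodule.exists_le_ker_of_notMem (K := K) (p := ⊥) (v := v) (by simpa)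
  exact ⟨g, hg⟩

theorem pureTensor_ne_zero [Fintype ι] {m : ∀ i, M i} {v : V} (hm : ∀ i, m i ≠ 0) (hv : v ≠ 0) :
    pureTensor K m v ≠ 0 := by
  choose f hf using fun i => exists_dual_ne_zero (K := K) (hm i)
  obtain ⟨g, hg⟩ := exists_dual_ne_zero (K := K) hv
  obtain ⟨F, hF⟩ := exists_dual_pureTensor f g
  intro h0
  have := hF m v
  rw [h0, map_zero] at this
  exact mul_ne_zero (Finset.prod_ne_zero_iff.mpr fun i _ => hf i) hg this.symm

theorem exists_ne_zero_of_nontrivial [Nontrivial ((⨂[K] i, M i) ⊗[K] V)] :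
    ∃ (m : ∀ i, M i) (v : V), (∀ i, m i ≠ 0) ∧ v ≠ 0 := by
  by_contra! h
  have h0 : (⊥ : Submodule K ((⨂[K] i, M i) ⊗[K] V)) = ⊤ := eq_top_of_pureTensor_mem fun m v => by
    rw [Submodule.mem_bot]
    by_cases hm : ∀ i, m i ≠ 0
    · rw [h m v hm, pureTensor, TensorProduct.tmul_zero]
    · push Not at hm
      obtain ⟨i, hi⟩ := hm
      rw [pureTensor, MultilinearMap.map_coord_zero _ i hi, TensorProduct.zero_tmul]
  exact bot_ne_top h0

variable [Fintype ι] [DecidableEq ι] {L : Type*} [LieRing L] [LieAlgebra K L] [∀ i, LieRingModule L (M i)]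
  [∀ i, LieModule K L (M i)] [LieRingModule L V] [LieModule K L V]

variable (K L M V) in
/-- The action of `L` on the factor `M i` of `(⨂ M i) ⊗ V`. -/
noncomputable def factorAct (i : ι) : L →ₗ[K] Module.End K ((⨂[K] i, M i) ⊗[K] V) :=
  LinearMap.rTensorHom V ∘ₗ (PiTensorProduct.mapMultilinear K M M).toLinearMap 1 i ∘ₗ
    (LieModule.toEnd K L (M i) : L →ₗ[K] Module.End K (M i))

variable (K L M V) in
/-- The action of `L` on the factor `V` of `(⨂ M i) ⊗ V`. -/
noncomputable def lastAct : L →ₗ[K] Module.End K ((⨂[K] i, M i) ⊗[K] V) :=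
  LinearMap.lTensorHom _ ∘ₗ (LieModule.toEnd K L V : L →ₗ[K] Module.End K V)

theorem factorAct_pureTensor (i : ι) (x : L) (m : ∀ i, M i) (v : V) :
    factorAct K V M L i x (pureTensor K m v) =
      pureTensor K (Function.update m i ⁅x, m i⁆) v := by
  change PiTensorProduct.map _ _ ⊗ₜ[K] v = _
  rw [PiTensorProduct.map_tprod, pureTensor]
  congr 2
  funext j
  rcases eq_or_ne j i with rfl | h
  · simp
  · simp [h]

theorem lastAct_pureTensor (x : L) (m : ∀ i, M i) (v : V) :
    lastAct K V M L x (pureTensor K m v) = pureTensor K m ⁅x, v⁆ := rfl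

theorem lie_pureTensor (x : L) (m : ∀ i, M i) (v : V) :
    ⁅x, pureTensor K m v⁆ =
      ∑ i, pureTensor K (Function.update m i ⁅x, m i⁆) v + pureTensor K m ⁅x, v⁆ := by
  rw [pureTensor, TensorProduct.LieModule.lie_tmul_right, lie_tprod, TensorProduct.sum_tmul]
  rfl

theorem lie_eq_sum_factorAct (x : L) (u : (⨂[K] i, M i) ⊗[K] V) :
    ⁅x, u⁆ = ∑ i, factorAct K V M L i x u + lastAct K V M L x u := by
  let S : Submodule K ((⨂[K] i, M i) ⊗[K] V) := LinearMap.eqLocus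
    (LieModule.toEnd K L _ x : Module.End K ((⨂[K] i, M i) ⊗[K] V))
    (∑ i, factorAct K V M L i x + lastAct K V M L x)
  have hS : S = ⊤ := eq_top_of_pureTensor_mem fun m v => by
    rw [LinearMap.mem_eqLocus, LieModule.toEnd_apply_apply, lie_pureTensor, LinearMap.add_apply,
      LinearMap.sum_apply, lastAct_pureTensor]
    simp only [factorAct_pureTensor]
  have hu : u ∈ S := hS ▸ Submodule.mem_top
  rw [LinearMap.mem_eqLocus, LieModule.toEnd_apply_apply, LinearMap.add_apply,
    LinearMap.sum_apply] at hu
  exact hu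

theorem isLieRep_factorAct (i : ι) : IsLieRep (factorAct K V M L i) := by
  intro x y u
  let S : Submodule K ((⨂[K] i, M i) ⊗[K] V) := LinearMap.eqLocus (factorAct K V M L i ⁅x, y⁆)
    (factorAct K V M L i x * factorAct K V M L i y - factorAct K V M L i y * factorAct K V M L i x)
  have hS : S = ⊤ := eq_top_of_pureTensor_mem fun m v => by
    rw [LinearMap.mem_eqLocus, LinearMap.sub_apply, Module.End.mul_apply, Module.End.mul_apply]
    simp only [factorAct_pureTensor, Function.update_self, Function.update_idem]
    rw [lie_lie, pureTensor_update_sub]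
  exact (hS ▸ Submodule.mem_top : u ∈ S)

/-- The span of the pure tensors in a set which is stable under the action on each factor. -/
theorem span_pureTensor_lie_mem {D : Set ((∀ i, M i) × V)}
    (hD : ∀ p ∈ D, ∀ (x : L) (i : ι), (Function.update p.1 i ⁅x, p.1 i⁆, p.2) ∈ D)
    (hD' : ∀ p ∈ D, ∀ x : L, (p.1, ⁅x, p.2⁆) ∈ D) (x : L) {u : (⨂[K] i, M i) ⊗[K] V}
    (hu : u ∈ Submodule.span K ((fun p : (∀ i, M i) × V => pureTensor K p.1 p.2) '' D)) :
    ⁅x, u⁆ ∈ Submodule.span K ((fun p : (∀ i, M i) × V => pureTensor K p.1 p.2) '' D) := by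
  induction hu using Submodule.span_induction with
  | mem _ h =>
    obtain ⟨p, hp, rfl⟩ := h
    rw [lie_pureTensor]
    exact Submodule.add_mem _ (Submodule.sum_mem _ fun i _ =>
      Submodule.subset_span ⟨_, hD p hp x i, rfl⟩) (Submodule.subset_span ⟨_, hD' p hp x, rfl⟩)
  | zero => rw [lie_zero]; exact Submodule.zero_mem _
  | add u v _ _ hu hv => rw [lie_add]; exact Submodule.add_mem _ hu hv
  | smul c u _ hu => rw [lie_smul]; exact Submodule.smul_mem _ c hu

theorem span_pureTensor_eq_bot_or_eq_top
    [LieModule.IsIrreducible K L ((⨂[K] i, M i) ⊗[K] V)] {D : Set ((∀ i, M i) × V)}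
    (hD : ∀ p ∈ D, ∀ (x : L) (i : ι), (Function.update p.1 i ⁅x, p.1 i⁆, p.2) ∈ D)
    (hD' : ∀ p ∈ D, ∀ x : L, (p.1, ⁅x, p.2⁆) ∈ D) :
    Submodule.span K ((fun p : (∀ i, M i) × V => pureTensor K p.1 p.2) '' D) = ⊥ ∨
    Submodule.span K ((fun p : (∀ i, M i) × V => pureTensor K p.1 p.2) '' D) = ⊤ := by
  let N : LieSubmodule K L ((⨂[K] i, M i) ⊗[K] V) :=
    { Submodule.span K ((fun p : (∀ i, M i) × V => pureTensor K p.1 p.2) '' D) with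
      lie_mem := fun {x u} hu => span_pureTensor_lie_mem hD hD' x hu }
  rcases eq_bot_or_eq_top N with h | h
  · exact Or.inl ((LieSubmodule.toSubmodule_eq_bot N).mpr h)
  · exact Or.inr ((LieSubmodule.toSubmodule_eq_top N).mpr h)

/-- If a tensor product is irreducible, then so are its factors: the case of `M i`. -/
theorem factor_eq_bot_or_eq_top [LieModule.IsIrreducible K L ((⨂[K] i, M i) ⊗[K] V)] (i : ι)
    (S : Submodule K (M i)) (hS : ∀ x : L, ∀ m ∈ S, ⁅x, m⁆ ∈ S) : S = ⊥ ∨ S = ⊤ := by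
  have : Nontrivial ((⨂[K] i, M i) ⊗[K] V) :=
    (LieSubmodule.nontrivial_iff K L _).mp inferInstance
  obtain ⟨m₀, v₀, hm₀, hv₀⟩ := exists_ne_zero_of_nontrivial (K := K) (M := M) (V := V)
  rcases span_pureTensor_eq_bot_or_eq_top (K := K) (L := L) (D := {p : (∀ i, M i) × V | p.1 i ∈ S})
    (fun p hp x j => by
      rcases eq_or_ne j i with rfl | h
      · simpa using hS x _ hp
      · simpa [h.symm] using hp) (fun p hp x => hp) with h | h
  · refine Or.inl ((Submodule.eq_bot_iff S).mpr fun s hs => ?_)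
    by_contra hs0
    refine pureTensor_ne_zero (K := K) (m := Function.update m₀ i s) (fun j => ?_) hv₀
      ((Submodule.mem_bot K).mp (h ▸ Submodule.subset_span
        ⟨(Function.update m₀ i s, v₀), by simpa using hs, rfl⟩))
    rcases eq_or_ne j i with rfl | hj
    · simpa using hs0
    · simpa [hj] using hm₀ j
  · refine Or.inr (eq_top_iff.mpr fun y _ => ?_)
    by_contra hy
    obtain ⟨f, hf, hfS⟩ := Submodule.exists_le_ker_of_notMem hy
    choose f' hf' using fun i => exists_dual_ne_zero (K := K) (hm₀ i)
    obtain ⟨g, hg⟩ := exists_dual_ne_zero (K := K) hv₀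
    obtain ⟨F, hF⟩ := exists_dual_pureTensor (Function.update f' i f) g
    -- A product functional that kills `S` in position `i` vanishes on the whole span, but not on a
    -- pure tensor with `y` in that position.
    have hle : Submodule.span K ((fun p : (∀ i, M i) × V => pureTensor K p.1 p.2) ''
        {p | p.1 i ∈ S}) ≤ LinearMap.ker F := by
      rw [Submodule.span_le]
      rintro _ ⟨p, hp, rfl⟩
      change F _ = 0
      rw [hF, Finset.prod_eq_zero (Finset.mem_univ i), zero_mul]
      simpa using hfS hp
    have h0 : F (pureTensor K (Function.update m₀ i y) v₀) = 0 :=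
      hle (by rw [h]; trivial)
    rw [hF] at h0
    refine mul_ne_zero (Finset.prod_ne_zero_iff.mpr fun j _ => ?_) hg h0
    rcases eq_or_ne j i with rfl | hj
    · simpa using hf
    · simpa [hj] using hf' j

/-- If a tensor product is irreducible, then so are its factors: the case of `V`. -/
theorem isIrreducible_of_tensor [LieModule.IsIrreducible K L ((⨂[K] i, M i) ⊗[K] V)] :
    LieModule.IsIrreducible K L V := by
  have : Nontrivial ((⨂[K] i, M i) ⊗[K] V) :=
    (LieSubmodule.nontrivial_iff K L _).mp inferInstance
  obtain ⟨m₀, v₀, hm₀, hv₀⟩ := exists_ne_zero_of_nontrivial (K := K) (M := M) (V := V)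
  have : Nontrivial V := ⟨v₀, 0, hv₀⟩
  refine LieModule.IsIrreducible.mk fun N hN => ?_
  rcases span_pureTensor_eq_bot_or_eq_top (K := K) (L := L) (D := {p : (∀ i, M i) × V | p.2 ∈ N})
    (fun p hp x j => hp) (fun p hp x => N.lie_mem hp) with h | h
  · refine absurd ((LieSubmodule.eq_bot_iff N).mpr fun s hs => ?_) hN
    by_contra hs0
    exact pureTensor_ne_zero (K := K) hm₀ hs0 ((Submodule.mem_bot K).mp (h ▸ Submodule.subset_span
        ⟨(m₀, s), hs, rfl⟩))
  · refine eq_top_iff.mpr fun y _ => ?_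
    by_contra hy
    obtain ⟨g, hg, hgN⟩ := Submodule.exists_le_ker_of_notMem (K := K) (p := N.toSubmodule) hy
    choose f hf using fun i => exists_dual_ne_zero (K := K) (hm₀ i)
    obtain ⟨F, hF⟩ := exists_dual_pureTensor f g
    have hle : Submodule.span K ((fun p : (∀ i, M i) × V => pureTensor K p.1 p.2) ''
        {p | p.2 ∈ N}) ≤ LinearMap.ker F := by
      rw [Submodule.span_le]
      rintro _ ⟨p, hp, rfl⟩
      change F _ = 0
      rw [hF, show g p.2 = 0 from hgN hp, mul_zero]
    have h0 : F (pureTensor K m₀ y) = 0 := hle (by rw [h]; trivial)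
    rw [hF] at h0
    exact mul_ne_zero (Finset.prod_ne_zero_iff.mpr fun i _ => hf i) hg h0

end Tensor

/-! ### Separating the action on the tensor factors -/

namespace Virasoro

section Separation

variable {ι V : Type*} {M : ι → Type*} [Fintype ι] [DecidableEq ι]
  [∀ i, AddCommGroup (M i)] [∀ i, Module ℂ (M i)] [AddCommGroup V] [Module ℂ V]
  [∀ i, LieRingModule Virasoro (M i)] [∀ i, LieModule ℂ Virasoro (M i)]
  [LieRingModule Virasoro V] [LieModule ℂ Virasoro V] {a : ι → ℂ}

theorem exists_factorAct_eq_zero (ha : ∀ i, a i ≠ 0)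
    (hM : ∀ i (m : M i), ∃ N, ∀ x ∈ pointFiltration (a i) N, ⁅x, m⁆ = 0)
    (hV : IsLocallyAnnihilated V) (u : (⨂[ℂ] i, M i) ⊗[ℂ] V) :
    ∃ N : ℕ, (∀ i, ∀ x ∈ pointFiltration (a i) N, factorAct ℂ V M Virasoro i x u = 0) ∧
      ∀ l : ℤ, (N : ℤ) ≤ l → lastAct ℂ V M Virasoro (e l) u = 0 := by
  let S : Submodule ℂ ((⨂[ℂ] i, M i) ⊗[ℂ] V) :=
    { carrier := {u | ∃ N : ℕ,
        (∀ i, ∀ x ∈ pointFiltration (a i) N, factorAct ℂ V M Virasoro i x u = 0) ∧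
        ∀ l : ℤ, (N : ℤ) ≤ l → lastAct ℂ V M Virasoro (e l) u = 0}
      add_mem' := by
        rintro u v ⟨N, h1, h2⟩ ⟨N', h1', h2'⟩
        refine ⟨max N N', fun i x hx => ?_, fun l hl => ?_⟩
        · rw [map_add, h1 i x ((isVectorFieldFiltration (ha i)).anti (le_max_left _ _) hx),
            h1' i x ((isVectorFieldFiltration (ha i)).anti (le_max_right _ _) hx), add_zero]
        · rw [map_add, h2 l (by omega), h2' l (by omega), add_zero]
      zero_mem' := ⟨0, fun _ _ _ => map_zero _, fun _ _ => map_zero _⟩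
      smul_mem' := by
        rintro c u ⟨N, h1, h2⟩
        exact ⟨N, fun i x hx => by rw [map_smul, h1 i x hx, smul_zero],
          fun l hl => by rw [map_smul, h2 l hl, smul_zero]⟩ }
  have hS : S = ⊤ := eq_top_of_pureTensor_mem fun m v => by
    choose N hN using fun i => hM i (m i)
    obtain ⟨N', hN'⟩ := hV v
    refine ⟨max (Finset.univ.sup N) N', fun i x hx => ?_, fun l hl => ?_⟩
    · rw [factorAct_pureTensor, hN i x ((isVectorFieldFiltration (ha i)).anti
        ((Finset.le_sup (Finset.mem_univ i)).trans (le_max_left _ _)) hx), pureTensor,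
        MultilinearMap.map_coord_zero _ i (by simp), TensorProduct.zero_tmul]
    · rw [lastAct_pureTensor, hN' l (by omega), pureTensor, TensorProduct.tmul_zero]
  exact (hS ▸ Submodule.mem_top : u ∈ S)

/-- The element `y` depends on `u`: it agrees with `x` at `a i`, and vanishes at the other points
and at `t = 0`, to an order at which the remaining contributions annihilate `u`. -/
theorem exists_lie_eq_factorAct (ha : ∀ i, a i ≠ 0) (hinj : Function.Injective a)
    (hM : ∀ i (m : M i), ∃ N, ∀ x ∈ pointFiltration (a i) N, ⁅x, m⁆ = 0)
    (hV : IsLocallyAnnihilated V) (u : (⨂[ℂ] i, M i) ⊗[ℂ] V) (i : ι) (x : Virasoro) :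
    ∃ y : Virasoro, ⁅y, u⁆ = factorAct ℂ V M Virasoro i x u := by
  obtain ⟨N, hN, hN'⟩ := exists_factorAct_eq_zero ha hM hV u
  obtain ⟨q, hq, hq'⟩ := exists_separating ha hinj i N (theta x)
  refine ⟨ofLaurent (LaurentPolynomial.T (N : ℤ) * Polynomial.toLaurent q), ?_⟩
  have hlast : ∀ q : Polynomial ℂ, lastAct ℂ V M Virasoro
      (ofLaurent (LaurentPolynomial.T (N : ℤ) * Polynomial.toLaurent q)) u = 0 := by
    intro q
    induction q using Polynomial.induction_on' with
    | add p q hp hq =>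
      rw [map_add, mul_add, map_add, map_add, LinearMap.add_apply, hp, hq, add_zero]
    | monomial l c =>
      rw [← Polynomial.C_mul_X_pow_eq_monomial, Polynomial.toLaurent_C_mul_X_pow, mul_left_comm,
        ← LaurentPolynomial.T_add, ← LaurentPolynomial.smul_eq_C_mul, map_smul, map_smul,
        LinearMap.smul_apply]
      exact (congrArg (c • ·) (hN' (N + l) (by omega))).trans (smul_zero c)
  rw [lie_eq_sum_factorAct (K := ℂ), hlast, add_zero, Finset.sum_eq_single i]
  · have := hN i (x - ofLaurent (LaurentPolynomial.T (N : ℤ) * Polynomial.toLaurent q))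
      (mem_pointFiltration.mpr (by rwa [map_sub, theta_ofLaurent]))
    rw [map_sub, LinearMap.sub_apply, sub_eq_zero] at this
    exact this.symm
  · intro j _ hj
    exact hN j _ (mem_pointFiltration.mpr (hq' j hj))
  · exact fun h => absurd (Finset.mem_univ i) h

theorem stableUnder_factorAct (ha : ∀ i, a i ≠ 0) (hinj : Function.Injective a)
    (hM : ∀ i (m : M i), ∃ N, ∀ x ∈ pointFiltration (a i) N, ⁅x, m⁆ = 0)
    (hV : IsLocallyAnnihilated V) (N : LieSubmodule ℂ Virasoro ((⨂[ℂ] i, M i) ⊗[ℂ] V)) (i : ι) :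
    StableUnder (factorAct ℂ V M Virasoro i) ⊤ N.toSubmodule := by
  intro x _ u hu
  obtain ⟨y, hy⟩ := exists_lie_eq_factorAct ha hinj hM hV u i x
  rw [← hy]
  exact N.lie_mem hu

/-- The action on `V` is the total action minus the actions on the other factors. -/
theorem stableUnder_lastAct (ha : ∀ i, a i ≠ 0) (hinj : Function.Injective a)
    (hM : ∀ i (m : M i), ∃ N, ∀ x ∈ pointFiltration (a i) N, ⁅x, m⁆ = 0)
    (hV : IsLocallyAnnihilated V) (N : LieSubmodule ℂ Virasoro ((⨂[ℂ] i, M i) ⊗[ℂ] V)) :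
    StableUnder (lastAct ℂ V M Virasoro) ⊤ N.toSubmodule := by
  intro x _ u hu
  rw [← add_sub_cancel_left (∑ i, factorAct ℂ V M Virasoro i x u) (lastAct ℂ V M Virasoro x u),
    ← lie_eq_sum_factorAct (K := ℂ)]
  exact Submodule.sub_mem _ (N.lie_mem hu)
    (Submodule.sum_mem _ fun i _ => stableUnder_factorAct ha hinj hM hV N i x trivial u hu)

end Separation

/-! ### Simplicity of the tensor product -/

section Sufficiency

set_option linter.unusedSectionVars false

variable {ι V : Type*} [Fintype ι] [DecidableEq ι] [AddCommGroup V] [Module ℂ V]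
  [LieRingModule Virasoro V] [LieModule ℂ Virasoro V] {a : ι → ℂ} {n : ι → ℕ}
  (μ : ∀ i, LieAlgebra.LieCharacter ℂ (polySubalgebra (linPow (a i) (n i))))

variable (V) in
/-- The span of the pure tensors whose components in `S` are the canonical generators. -/
noncomputable def genSpan (S : Finset ι) : Submodule ℂ ((⨂[ℂ] i, InducedVir (μ i)) ⊗[ℂ] V) :=
  Submodule.span ℂ {t | ∃ m v, (∀ i ∈ S, m i = indGen (μ i)) ∧ t = pureTensor ℂ m v}

variable {μ}

/-- `InducedVir (μ i)` is generated by `indGen (μ i)`, so acting on factor `i` alone recovers any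
component there. This lets `exists_mem_of_stable` treat factor `i` with the others as multiplicity
space. -/
theorem genSpan_le_stableClosure {S : Finset ι} {i : ι} (hi : i ∉ S) :
    genSpan V μ S ≤ stableClosure (factorAct ℂ V (fun i => InducedVir (μ i)) Virasoro i) ⊤
      (genSpan V μ (insert i S)) := by
  refine Submodule.span_le.mpr ?_
  rintro _ ⟨m, v, hm, rfl⟩
  set C := stableClosure (factorAct ℂ V (fun i => InducedVir (μ i)) Virasoro i) ⊤
    (genSpan V μ (insert i S)) with hC
  let f : InducedVir (μ i) →ₗ[ℂ] (⨂[ℂ] i, InducedVir (μ i)) ⊗[ℂ] V :=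
    (TensorProduct.mk ℂ _ V).flip v ∘ₗ (PiTensorProduct.tprod ℂ).toLinearMap m i
  have hf : ∀ y, f y = pureTensor ℂ (Function.update m i y) v := fun y => rfl
  have htop : C.comap f = ⊤ := by
    refine InducedModule.eq_top_of_gen_mem _ _ _ ?_ fun x y hy => ?_
    · rw [Submodule.mem_comap, hf]
      refine le_stableClosure (Submodule.subset_span ⟨_, v, fun j hj => ?_, rfl⟩)
      rcases eq_or_ne j i with rfl | hji
      · simp
      · simpa [hji] using hm j (Finset.mem_of_mem_insert_of_ne hj hji)
    · rw [Submodule.mem_comap, hf] at hy ⊢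
      have := stableUnder_stableClosure x Submodule.mem_top _ hy
      rwa [factorAct_pureTensor, Function.update_self, Function.update_idem] at this
  have : m i ∈ C.comap f := htop ▸ Submodule.mem_top
  rwa [Submodule.mem_comap, hf, Function.update_eq_self] at this

theorem factorAct_eq_smul_of_mem_genSpan {S : Finset ι} {i : ι} (hi : i ∈ S)
    {ν : Virasoro →ₗ[ℂ] ℂ} (hν : Extends ν (μ i)) {x : Virasoro}
    (hx : x ∈ pointFiltration (a i) (n i)) {u : (⨂[ℂ] i, InducedVir (μ i)) ⊗[ℂ] V}
    (hu : u ∈ genSpan V μ S) :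
    factorAct ℂ V (fun i => InducedVir (μ i)) Virasoro i x u = ν x • u := by
  have hle : genSpan V μ S ≤ LinearMap.eqLocus
      (factorAct ℂ V (fun i => InducedVir (μ i)) Virasoro i x) (ν x • LinearMap.id) := by
    refine Submodule.span_le.mpr ?_
    rintro _ ⟨m, v, hm, rfl⟩
    rw [SetLike.mem_coe, LinearMap.mem_eqLocus, LinearMap.smul_apply, LinearMap.id_apply,
      factorAct_pureTensor, hm i hi, hν.lie_indGen hx, pureTensor,
      MultilinearMap.map_update_smul, ← hm i hi, Function.update_eq_self,
      ← TensorProduct.smul_tmul']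
    rfl
  exact hle hu

theorem genSpan_univ_le :
    genSpan V μ Finset.univ ≤
      LinearMap.range (TensorProduct.mk ℂ (⨂[ℂ] i, InducedVir (μ i)) V
        (PiTensorProduct.tprod ℂ fun i => indGen (μ i))) := by
  refine Submodule.span_le.mpr ?_
  rintro _ ⟨m, v, hm, rfl⟩
  obtain rfl : m = fun i => indGen (μ i) := funext fun i => hm i (Finset.mem_univ i)
  exact ⟨v, rfl⟩

theorem genSpan_empty : genSpan V μ ∅ = ⊤ :=
  eq_top_of_pureTensor_mem fun m v => Submodule.subset_span ⟨m, v, by simp, rfl⟩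

theorem isIrreducible_tensor (ha : ∀ i, a i ≠ 0) (hinj : Function.Injective a)
    (hn : ∀ i, 1 ≤ n i) (hV : IsLocallyAnnihilated V) (hirr : LieModule.IsIrreducible ℂ Virasoro V)
    (hμ : ∀ i, μ i ≠ 0 ∧ ∃ r : ℤ, HasDegree (μ i) r ∧ (n i : ℤ) - 2 ≤ r) :
    LieModule.IsIrreducible ℂ Virasoro ((⨂[ℂ] i, InducedVir (μ i)) ⊗[ℂ] V) := by
  have hM : ∀ i (m : InducedVir (μ i)), ∃ N, ∀ x ∈ pointFiltration (a i) N, ⁅x, m⁆ = 0 :=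
    fun i m => exists_pointFiltration_lie_eq_zero (ha i) m
  have : Nontrivial V := (LieSubmodule.nontrivial_iff ℂ Virasoro _).mp inferInstance
  obtain ⟨v₀, hv₀⟩ := exists_ne (0 : V)
  have : Nontrivial ((⨂[ℂ] i, InducedVir (μ i)) ⊗[ℂ] V) :=
    ⟨pureTensor ℂ (fun i => indGen (μ i)) v₀, 0,
      pureTensor_ne_zero (fun i => indGen_ne_zero (ha i)) hv₀⟩
  refine LieModule.IsIrreducible.mk fun N hN => ?_
  have hfac := stableUnder_factorAct ha hinj hM hV N
  have hlast := stableUnder_lastAct ha hinj hM hV N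
  -- The components are turned into generators one factor at a time, keeping a nonzero element of
  -- `N`.
  have hmeet : ∀ S : Finset ι, ∃ u ∈ N, u ∈ genSpan V μ S ∧ u ≠ 0 := by
    intro S
    induction S using Finset.induction_on with
    | empty =>
      by_contra! h
      exact hN ((LieSubmodule.eq_bot_iff N).mpr fun u hu =>
        h u hu (by rw [genSpan_empty]; trivial))
    | insert i S hi ih =>
      obtain ⟨u, hu, huS, hu0⟩ := ih
      obtain ⟨ν, hν⟩ := exists_extends (μ i)
      obtain ⟨r, hr, hnr⟩ := (hμ i).2
      obtain ⟨m, hm1, hm2, hm3, hm4⟩ := hν.exists_order (ha i) (hμ i).1 hr hnr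
      refine (isVectorFieldFiltration (ha i)).exists_mem_of_stable (isLieRep_factorAct i) (hn i)
        hm1 hm2 hm3 hm4 (fun x hx u hu => factorAct_eq_smul_of_mem_genSpan
          (Finset.mem_insert_self i S) hν hx hu) (fun x hx => ?_) (hfac i) hu
        (genSpan_le_stableClosure hi huS) hu0
      -- Vanishing to every order at `a i` forces `x` to act as zero on factor `i`, as each tensor
      -- is killed there by some `pointFiltration (a i) N'`.
      refine LinearMap.ext fun t => ?_
      obtain ⟨N', hN', -⟩ := exists_factorAct_eq_zero ha hM hV t
      exact hN' i x (hx N')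
  obtain ⟨u, huN, hu, hu0⟩ := hmeet Finset.univ
  obtain ⟨v, rfl⟩ := genSpan_univ_le hu
  -- The vectors of `V` whose tensor with the generators is in `N` form a submodule, because `N` is
  -- stable under the action on `V` alone; simplicity of `V` makes it everything.
  let W : LieSubmodule ℂ Virasoro V :=
    { N.toSubmodule.comap (TensorProduct.mk ℂ (⨂[ℂ] i, InducedVir (μ i)) V
        (PiTensorProduct.tprod ℂ fun i => indGen (μ i))) with
      lie_mem := fun {x v} hv => hlast x trivial _ hv }
  have hW : W = ⊤ := by
    refine (eq_bot_or_eq_top W).resolve_left fun h => hu0 ?_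
    have hv : v ∈ W := huN
    rw [h, LieSubmodule.mem_bot] at hv
    rw [hv, map_zero]
  have hgen : ∀ v, pureTensor ℂ (fun i => indGen (μ i)) v ∈ N := fun v =>
    (hW ▸ LieSubmodule.mem_top v : v ∈ W)
  -- Conversely, the components are freed one at a time: starting from the generators, the action on
  -- factor `i` reaches all of `InducedVir (μ i)`.
  have hall : ∀ (S : Finset ι) (m : ∀ i, InducedVir (μ i)) (v : V),
      (∀ i ∉ S, m i = indGen (μ i)) → pureTensor ℂ m v ∈ N := by
    intro S
    induction S using Finset.induction_on with
    | empty =>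
      intro m v hm
      obtain rfl : m = fun i => indGen (μ i) := funext fun i => hm i (Finset.notMem_empty i)
      exact hgen v
    | insert i S hi ih =>
      intro m v hm
      let f : InducedVir (μ i) →ₗ[ℂ] (⨂[ℂ] i, InducedVir (μ i)) ⊗[ℂ] V :=
        (TensorProduct.mk ℂ _ V).flip v ∘ₗ (PiTensorProduct.tprod ℂ).toLinearMap m i
      have hf : ∀ y, f y = pureTensor ℂ (Function.update m i y) v := fun y => rfl
      have htop : N.toSubmodule.comap f = ⊤ := by
        refine InducedModule.eq_top_of_gen_mem _ _ _ ?_ fun x y hy => ?_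
        · rw [Submodule.mem_comap, hf]
          refine ih _ v fun j hj => ?_
          rcases eq_or_ne j i with rfl | hji
          · simp
          · rw [Function.update_of_ne hji]
            exact hm j (by simp [hji, hj])
        · rw [Submodule.mem_comap, hf] at hy ⊢
          have := hfac i x trivial _ hy
          rwa [factorAct_pureTensor, Function.update_self, Function.update_idem] at this
      have : m i ∈ N.toSubmodule.comap f := htop ▸ Submodule.mem_top
      rwa [Submodule.mem_comap, hf, Function.update_eq_self] at this
  refine (LieSubmodule.toSubmodule_eq_top N).mp (eq_top_of_pureTensor_mem fun m v => ?_)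
  exact hall Finset.univ m v fun i hi => absurd (Finset.mem_univ i) hi

end Sufficiency

end Virasoro

/-! ### The simplicity criterion -/

theorem mainTheorem1 (k : ℕ) (hk : 1 ≤ k) (a : Fin k → ℂ) (ha : ∀ i, a i ≠ 0)
    (hinj : Function.Injective a) (n : Fin k → ℕ) (hn : ∀ i, 1 ≤ n i)
    (μ : ∀ i, LieAlgebra.LieCharacter ℂ (Virasoro.polySubalgebra (Virasoro.linPow (a i) (n i))))
    (V : Type*) [AddCommGroup V] [Module ℂ V] [LieRingModule Virasoro V]
    [LieModule ℂ Virasoro V] (hV : Virasoro.IsLocallyAnnihilated V) :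
    LieModule.IsIrreducible ℂ Virasoro ((⨂[ℂ] i, Virasoro.InducedVir (μ i)) ⊗[ℂ] V) ↔
      LieModule.IsIrreducible ℂ Virasoro V ∧
        ∀ i, μ i ≠ 0 ∧ ∃ r : ℤ, Virasoro.HasDegree (μ i) r ∧ (n i : ℤ) - 2 ≤ r := by
  refine ⟨fun h => ⟨isIrreducible_of_tensor (M := fun i => Virasoro.InducedVir (μ i)),
    fun i => ?_⟩, fun h => Virasoro.isIrreducible_tensor ha hinj hn hV h.1 h.2⟩
  by_contra hi
  obtain ⟨ν, hν, hν'⟩ := Virasoro.exists_extends_lie_eq_zero (ha i) (hn i) hi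
  obtain ⟨K, hK, hbot, htop⟩ := Virasoro.exists_proper_submodule (ha i) (hn i) hν hν'
  exact (factor_eq_bot_or_eq_top (L := Virasoro) (V := V)
    (M := fun i => Virasoro.InducedVir (μ i)) i K hK).elim hbot htop
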